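/- **Theorem 4.1 (zeroth-order $\Gamma$-convergence).** *Setting.* Let $N,M\ge 1$, let $\Omega\subset\mathbb R^N$ be bounded and open, and let $Q=(-1/2,1/2)^N$. Let $E_1,\dots,E_k\subset Q$ be pairwise disjoint open sets whose boundaries are contained in finite unions of affine hyperplanes, with $Q=\bigcup_i(\overline{E_i}\cap Q)$. Let $W:\mathbb R^N\times\mathbb R^M\to[0,\infty)$ and $a,b:\mathbb R^N\to\mathbb R^M$ be Lebesgue measurable. For $x\in\mathbb R^N$ write $x=\lfloor x\rfloor+y$, where $\lfloor x\rfloor$ is the nearest integer point (unique for a.e. $x$, in which case $y\in Q$). Assume: 1. $W(x+z,p)=W(x,p)$ for all $x\in\mathbb R^N$, $z\in\mathbb Z^N$, $p\in\mathbb R^M$. 2. For a.e. $x\in\mathbb R^N$ and all $p$, $W(x,p)=\sum_i\chi_{E_i}(y)W_i(y,p)$, where each $W_i:\overline{E_i}\times\mathbb R^M\to[0,\infty)$ is locally Lipschitz. 3. For a.e. $x\in\mathbb R^N$, $a(x)=\sum_i\chi_{E_i}(y)a_i(y)$ and $b(x)=\sum_i\chi_{E_i}(y)b_i(y)$, where $a_i,b_i:\overline{E_i}\to\mathbb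 R^M$ are Lipschitz; and for a.e. $x$, $W(x,p)=0$ if and only if $p\in\{a(x),b(x)\}$. 4. For every $i$ and a.e. $y_0\in E_i$ with $a_i(y_0)\ne b_i(y_0)$ there are $\mu,R,c_1>0$ such that for all $y\in B(y_0,\mu)\cap\overline{E_i}$: $\frac1{c_1}|p-a_i(y)|^2\le W_i(y,p)\le c_1|p-a_i(y)|^2$ whenever $|p-a_i(y)|\le R$, and $\frac1{c_1}|p-b_i(y)|^2\le W_i(y,p)\le c_1|p-b_i(y)|^2$ whenever $|p-b_i(y)|\le R$. 5. There is $c_2>0$ such that for a.e. $x\in\mathbb R^N$: $W(x,p)\ge\frac1{c_2}|p|^2$ if $|p|\ge c_2$, and $W(x,p)\le c_2(1+|p|^2)$ for all $p$. Let $\varepsilon_n,\delta_n\in(0,1)$ with $\varepsilon_n\to0$, $\delta_n\to0$ and $\varepsilon_n/\delta_n\to0$. For $u\in L^2(\Omega;\mathbb R^M)$ put $$G_n(u)=\int_\Omega\Big[W\Big(\frac{x}{\delta_n},u(x)\Big)+\varepsilon_n^2|\nabla u(x)|^2\Big]dx\ \text{ if } u\in W^{1,2}(\Omega;\mathbb R^M),\qquad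 G_n(u)=+\infty\ \text{ otherwise},$$ where $|\nabla u|$ is the Frobenius norm of the weak gradient. For each $y$ let $W^{**}(y,\cdot)$ be the convex envelope of $W(y,\cdot)$, and put $$W^{\rm hom}(p)=\min\Big\{\int_Q W^{**}(y,p+\varphi(y))\,dy:\ \varphi\in L^2(Q;\mathbb R^M),\ \int_Q\varphi\,dy=0\Big\},\qquad G^0(u)=\int_\Omega W^{\rm hom}(u(x))\,dx .$$ *Conclusion.* (i) The minimum defining $W^{\rm hom}(p)$ is attained for every $p\in\mathbb R^M$. (ii) If $\sup_nG_n(u_n)<\infty$, then there are a subsequence and $u\in L^2(\Omega;\mathbb R^M)$ with $u_{n_j}\rightharpoonup u$ weakly in $L^2(\Omega;\mathbb R^M)$ and $G^0(u)<\infty$. (iii) $G_n$ $\Gamma$-converges to $G^0$ with respect to weak $L^2$ convergence: for every $u\in L^2(\Omega;\mathbb R^M)$, $G^0(u)\le\liminf_nG_n(u_n)$ whenever $u_n\rightharpoonup u$ weakly in $L^2$, and there is a sequence $u_n\rightharpoonup u$ weakly in $L^2$ with $\limsup_nG_n(u_n)\le G^0(u)$. -/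

import Mathlib

open MeasureTheory Filter Topology Set
open scoped ENNReal ContDiff

noncomputable section

/-- The open unit cube `(-1/2, 1/2)^N`. -/
def unitCube (N : ℕ) : Set (EuclideanSpace ℝ (Fin N)) :=
  {y | ∀ j, y j ∈ Ioo (-(1 / 2) : ℝ) (1 / 2)}

/-- The point `x - ⌊x⌋` of the (closed) unit cube, where `⌊x⌋` is the integer point nearest to `x`;
ties between several nearest points happen only on a null set. -/
def cellPart {N : ℕ} (x : EuclideanSpace ℝ (Fin N)) : EuclideanSpace ℝ (Fin N) :=
  WithLp.toLp 2 fun j => x j - (round (x j) : ℝ)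

/-- The boundary is contained in a finite union of affine hyperplanes. -/
def HasPiecewiseAffineBoundary {N : ℕ} (s : Set (EuclideanSpace ℝ (Fin N))) : Prop :=
  ∃ S : Finset (EuclideanSpace ℝ (Fin N) × ℝ),
    (∀ h ∈ S, h.1 ≠ 0) ∧ ∀ x ∈ frontier s, ∃ h ∈ S, inner ℝ h.1 x = h.2

/-- The standing assumptions on a double well potential `W` with wells `a`, `b`, where the unit
cube is partitioned into the sets `E i`, and `Wp i`, `ap i`, `bp i` are the regular pieces of
`W`, `a`, `b`, which matter only on the closure of `E i`. -/
structure IsDoubleWell {N M k : ℕ}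
    (W : EuclideanSpace ℝ (Fin N) → EuclideanSpace ℝ (Fin M) → ℝ)
    (a b : EuclideanSpace ℝ (Fin N) → EuclideanSpace ℝ (Fin M))
    (E : Fin k → Set (EuclideanSpace ℝ (Fin N)))
    (Wp : Fin k → EuclideanSpace ℝ (Fin N) → EuclideanSpace ℝ (Fin M) → ℝ)
    (ap bp : Fin k → EuclideanSpace ℝ (Fin N) → EuclideanSpace ℝ (Fin M)) : Prop where
  isOpen_piece : ∀ i, IsOpen (E i)
  piece_subset : ∀ i, E i ⊆ unitCube N
  disjoint_piece : ∀ i j, i ≠ j → Disjoint (E i) (E j)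
  piecewise_affine : ∀ i, HasPiecewiseAffineBoundary (E i)
  cover : unitCube N = ⋃ i, closure (E i) ∩ unitCube N
  nonneg : ∀ x p, 0 ≤ W x p
  /-- Lebesgue measurability of `W`, `a`, `b` -/
  measurable_W : AEMeasurable (fun z : EuclideanSpace ℝ (Fin N) × EuclideanSpace ℝ (Fin M) =>
    W z.1 z.2) volume
  measurable_a : AEMeasurable a volume
  measurable_b : AEMeasurable b volume
  periodic : ∀ (x : EuclideanSpace ℝ (Fin N)) (z : Fin N → ℤ) (p : EuclideanSpace ℝ (Fin M)),
    W (x + WithLp.toLp 2 fun j => (z j : ℝ)) p = W x p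
  W_eq : ∀ᵐ x : EuclideanSpace ℝ (Fin N), ∀ p,
    W x p = ∑ i, (E i).indicator (fun y => Wp i y p) (cellPart x)
  piece_nonneg : ∀ i, ∀ y ∈ closure (E i), ∀ p, 0 ≤ Wp i y p
  piece_locallyLipschitz : ∀ i, LocallyLipschitzOn (closure (E i) ×ˢ univ)
    (fun z : EuclideanSpace ℝ (Fin N) × EuclideanSpace ℝ (Fin M) => Wp i z.1 z.2)
  a_eq : ∀ᵐ x : EuclideanSpace ℝ (Fin N), a x = ∑ i, (E i).indicator (ap i) (cellPart x)
  b_eq : ∀ᵐ x : EuclideanSpace ℝ (Fin N), b x = ∑ i, (E i).indicator (bp i) (cellPart x)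
  a_lipschitz : ∀ i, ∃ K, LipschitzOnWith K (ap i) (closure (E i))
  b_lipschitz : ∀ i, ∃ K, LipschitzOnWith K (bp i) (closure (E i))
  zero_iff : ∀ᵐ x : EuclideanSpace ℝ (Fin N), ∀ p, W x p = 0 ↔ p = a x ∨ p = b x
  /-- quadratic bounds near the wells, locally uniform where the wells are distinct -/
  quadratic : ∀ i, ∀ᵐ y₀ : EuclideanSpace ℝ (Fin N), y₀ ∈ E i → ap i y₀ ≠ bp i y₀ →
    ∃ μ > (0 : ℝ), ∃ R > (0 : ℝ), ∃ c₁ > (0 : ℝ), ∀ y ∈ Metric.ball y₀ μ ∩ closure (E i), ∀ p,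
      (‖p - ap i y‖ ≤ R →
        1 / c₁ * ‖p - ap i y‖ ^ 2 ≤ Wp i y p ∧ Wp i y p ≤ c₁ * ‖p - ap i y‖ ^ 2) ∧
      (‖p - bp i y‖ ≤ R →
        1 / c₁ * ‖p - bp i y‖ ^ 2 ≤ Wp i y p ∧ Wp i y p ≤ c₁ * ‖p - bp i y‖ ^ 2)
  /-- quadratic growth at infinity -/
  growth : ∃ c₂ > (0 : ℝ), ∀ᵐ x : EuclideanSpace ℝ (Fin N), ∀ p,
    (c₂ ≤ ‖p‖ → 1 / c₂ * ‖p‖ ^ 2 ≤ W x p) ∧ W x p ≤ c₂ * (1 + ‖p‖ ^ 2)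

/-- The Hilbert space `L²(Ω; ℝ^M)`. -/
abbrev L2 {N : ℕ} (Ω : Set (EuclideanSpace ℝ (Fin N))) (M : ℕ) : Type :=
  Lp (EuclideanSpace ℝ (Fin M)) 2 (volume.restrict Ω)

/-- `g` is a weak gradient of `u` on `Ω` that lies in `L²`; here `g j` is the weak partial
derivative of `u` in the direction of the `j`-th coordinate. -/
def IsWeakGradient {N M : ℕ} (Ω : Set (EuclideanSpace ℝ (Fin N)))
    (u : EuclideanSpace ℝ (Fin N) → EuclideanSpace ℝ (Fin M))
    (g : Fin N → EuclideanSpace ℝ (Fin N) → EuclideanSpace ℝ (Fin M)) : Prop :=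
  (∀ j, MemLp (g j) 2 (volume.restrict Ω)) ∧
  ∀ j, ∀ φ : EuclideanSpace ℝ (Fin N) → ℝ,
    ContDiff ℝ ∞ φ → HasCompactSupport φ → tsupport φ ⊆ Ω →
      (∫ x in Ω, fderiv ℝ φ x (EuclideanSpace.single j 1) • u x) = - ∫ x in Ω, φ x • g j x

/-- The Sobolev space `W^{1,2}(Ω; ℝ^M)`, as a subset of `L²(Ω; ℝ^M)`. -/
def sobolevW12 {N : ℕ} (Ω : Set (EuclideanSpace ℝ (Fin N))) (M : ℕ) : Set (L2 Ω M) :=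
  {u | ∃ g, IsWeakGradient Ω u g}

/-- The weak gradient of a function of `W^{1,2}(Ω; ℝ^M)` (unique almost everywhere in `Ω`). -/
def weakGradient {N M : ℕ} {Ω : Set (EuclideanSpace ℝ (Fin N))} {u : L2 Ω M}
    (hu : u ∈ sobolevW12 Ω M) :
    Fin N → EuclideanSpace ℝ (Fin N) → EuclideanSpace ℝ (Fin M) :=
  hu.choose

open Classical in
/-- The energy `∫_Ω W(x/δ, u) + ε² |∇u|²` on `W^{1,2}`, extended by `+∞` to `L²`;
`|∇u|` is the Frobenius norm. -/
def phaseEnergy {N M : ℕ} (Ω : Set (EuclideanSpace ℝ (Fin N)))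
    (W : EuclideanSpace ℝ (Fin N) → EuclideanSpace ℝ (Fin M) → ℝ) (ε δ : ℝ)
    (u : L2 Ω M) : ℝ≥0∞ :=
  if hu : u ∈ sobolevW12 Ω M then
    ∫⁻ x in Ω, ENNReal.ofReal
      (W (δ⁻¹ • x) (u x) + ε ^ 2 * ∑ j, ‖weakGradient hu j x‖ ^ 2)
  else ⊤

/-- The convex envelope of a nonnegative function: the pointwise supremum of its convex
minorants. -/
def convexEnvelope {M : ℕ} (f : EuclideanSpace ℝ (Fin M) → ℝ) (p : EuclideanSpace ℝ (Fin M)) :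
    ℝ :=
  sSup {t | ∃ g : EuclideanSpace ℝ (Fin M) → ℝ, ConvexOn ℝ univ g ∧ (∀ q, g q ≤ f q) ∧ g p = t}

/-- The values `∫_Q W^{**}(y, p + φ(y)) dy` over all `φ ∈ L²(Q; ℝ^M)` with zero mean. -/
def cellValues {N M : ℕ} (W : EuclideanSpace ℝ (Fin N) → EuclideanSpace ℝ (Fin M) → ℝ)
    (p : EuclideanSpace ℝ (Fin M)) : Set ℝ≥0∞ :=
  {t | ∃ φ : EuclideanSpace ℝ (Fin N) → EuclideanSpace ℝ (Fin M),
    MemLp φ 2 (volume.restrict (unitCube N)) ∧ (∫ y in unitCube N, φ y) = 0 ∧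
    t = ∫⁻ y in unitCube N, ENNReal.ofReal (convexEnvelope (W y) (p + φ y))}

/-- The homogenized potential. -/
def homPotential {N M : ℕ} (W : EuclideanSpace ℝ (Fin N) → EuclideanSpace ℝ (Fin M) → ℝ)
    (p : EuclideanSpace ℝ (Fin M)) : ℝ≥0∞ :=
  sInf (cellValues W p)

/-- The limit functional `∫_Ω W^hom(u)`. -/
def homEnergy {N M : ℕ} (Ω : Set (EuclideanSpace ℝ (Fin N)))
    (W : EuclideanSpace ℝ (Fin N) → EuclideanSpace ℝ (Fin M) → ℝ) (u : L2 Ω M) : ℝ≥0∞ :=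
  ∫⁻ x in Ω, homPotential W (u x)

/-- Weak convergence in `L²(Ω; ℝ^M)`. -/
def WeaklyConverges {N M : ℕ} {Ω : Set (EuclideanSpace ℝ (Fin N))}
    (u : ℕ → L2 Ω M) (v : L2 Ω M) : Prop :=
  Tendsto (fun n => toWeakSpace ℝ (L2 Ω M) (u n)) atTop (𝓝 (toWeakSpace ℝ (L2 Ω M) v))

/-- Γ-convergence with respect to weak convergence in `L²(Ω; ℝ^M)`: the liminf inequality along
every weakly convergent sequence, and the existence of recovery sequences. -/
def GammaConverges {N M : ℕ} {Ω : Set (EuclideanSpace ℝ (Fin N))}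
    (G : ℕ → L2 Ω M → ℝ≥0∞) (G₀ : L2 Ω M → ℝ≥0∞) : Prop :=
  (∀ (v : L2 Ω M) (u : ℕ → L2 Ω M), WeaklyConverges u v →
    G₀ v ≤ liminf (fun n => G n (u n)) atTop) ∧
  (∀ v : L2 Ω M, ∃ u : ℕ → L2 Ω M, WeaklyConverges u v ∧
    limsup (fun n => G n (u n)) atTop ≤ G₀ v)

end

/-!
The proof is by convex duality and uses only that the potential is a periodic Carathéodory
function with two-sided quadratic growth (`IsPeriodicPotential`); after a change on a null set these
properties hold at every point (`IsDoubleWell.exists_isPeriodicPotential`). Write `V` for it, `V*`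
for the conjugate of `V` in the second variable (`legendre`), and `h ξ = ∫_Q V*(y, ξ) dy`
(`meanConjugate`). The homogenized potential turns out to be the conjugate `h*` of `h`.

*Lower bounds.* From `V(x / δ, p) ≥ ⟪ξ, p⟫ - V*(x / δ, ξ)`, and since `V*(x / δ, ξ)` converges weakly
to its mean `h ξ` (`tendsto_integral_oscillating`), the energies of a weakly convergent sequence are
asymptotically at least `∫ ⟪ξ(x), u(x)⟫ - h(ξ(x))` for every `ξ` with finitely many values. The
supremum over `ξ` is `∫ h*(u)`, by a measurable selection (`exists_measurable_selection`). The same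
argument without oscillations, `eventually_integral_le_of_affine_minorants`, shows that weak limits
of almost optimal competitors solve the convexified cell problem, so that the minimum is attained
(`IsPeriodicPotential.isLeast_cellValues`).

*Upper bounds.* The means and energies `(∫_Q w, ∫_Q V(y, w))` of bounded functions `w` form a set
with convex closure, because two competitors can be mixed finely with prescribed volume fractions.
If `(p, h*(p))` were not in the closure, a separating hyperplane would contradict the definition of
`h`; see `IsPeriodicPotential.mk_legendre_meanConjugate_mem_closure`. Hence for each `p` there is a
smooth periodic `w` with mean close to `p` and energy close to `h*(p)`. For `u` close to a simple
function, the functions `w_p(x / δ)` for the values `p`, glued by fixed smooth cutoff functions, have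
nearly optimal energy; their gradients are of order `1 / δ`, which `ε / δ → 0` makes negligible
(`IsPeriodicPotential.exists_recovery_simpleFunc`). Since the energies control the `L²` norm, a
diagonal argument removes the errors (`exists_recovery_of_approximate`).
-/

/-! ### Periodic functions and the unit cube -/

/-- `f` is invariant under translations by points with integer coordinates. -/
def LatticePeriodic {N : ℕ} {α : Type*} (f : EuclideanSpace ℝ (Fin N) → α) : Prop :=
  ∀ (x : EuclideanSpace ℝ (Fin N)) (z : Fin N → ℤ), f (x + WithLp.toLp 2 fun j => (z j : ℝ)) = f x

section Cube

variable {N : ℕ}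

theorem isOpen_unitCube : IsOpen (unitCube N) := by
  have h : unitCube N = ⋂ j, (fun y : EuclideanSpace ℝ (Fin N) => y j) ⁻¹'
      Ioo (-(1 / 2) : ℝ) (1 / 2) := by
    ext y; simp [unitCube]
  rw [h]
  exact isOpen_iInter_of_finite fun j => isOpen_Ioo.preimage (by fun_prop)

theorem measurableSet_unitCube : MeasurableSet (unitCube N) := isOpen_unitCube.measurableSet

theorem volume_euclidean_pi (s : Fin N → Set ℝ) :
    volume {y : EuclideanSpace ℝ (Fin N) | ∀ j, y j ∈ s j} = ∏ j, volume (s j) := by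
  rw [← volume_pi_pi, ← (EuclideanSpace.volume_preserving_symm_measurableEquiv_toLp
    (Fin N)).measure_preimage_equiv]
  congr 1
  ext y
  simp [Set.mem_pi]

theorem volume_unitCube : volume (unitCube N) = 1 := by
  rw [unitCube, volume_euclidean_pi]
  simp only [Real.volume_Ioo]
  norm_num

instance isProbabilityMeasure_restrict_unitCube :
    IsProbabilityMeasure (volume.restrict (unitCube N)) := ⟨by simp [volume_unitCube]⟩

open scoped Pointwise in
/-- Integrals of periodic functions do not depend on the position of the unit cube. -/
theorem LatticePeriodic.setIntegral_add {E : Type*} [NormedAddCommGroup E] [NormedSpace ℝ E]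
    {f : EuclideanSpace ℝ (Fin N) → E} (hf : LatticePeriodic f) (s : EuclideanSpace ℝ (Fin N)) :
    ∫ t in unitCube N, f (s + t) = ∫ t in unitCube N, f t := by
  set b := (EuclideanSpace.basisFun (Fin N) ℝ).toBasis
  set D := ZSpan.fundamentalDomain b
  set v : EuclideanSpace ℝ (Fin N) := WithLp.toLp 2 fun _ => (-(1 / 2) : ℝ)
  have hD : IsAddFundamentalDomain (Submodule.span ℤ (range b)) D volume :=
    ZSpan.isAddFundamentalDomain b volume
  -- the translate of the fundamental domain is the half-open cube with the same corner
  have hvD : v +ᵥ D = {y | ∀ j, y j ∈ Ico (-(1 / 2) : ℝ) (1 / 2)} := by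
    ext y
    rw [mem_vadd_set_iff_neg_vadd_mem, ZSpan.mem_fundamentalDomain]
    refine forall_congr' fun j => ?_
    simp only [b, v, OrthonormalBasis.coe_toBasis_repr_apply, EuclideanSpace.basisFun_repr,
      vadd_eq_add, PiLp.add_apply, PiLp.neg_apply, mem_Ico]
    constructor <;> rintro ⟨h1, h2⟩ <;> constructor <;> linarith
  have hQ : unitCube N =ᵐ[volume] (v +ᵥ D : Set _) := by
    have hvol : volume (v +ᵥ D : Set (EuclideanSpace ℝ (Fin N))) = 1 := by
      rw [hvD, volume_euclidean_pi]
      simp only [Real.volume_Ico]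
      norm_num
    refine ae_eq_of_subset_of_measure_ge ?_ (by rw [hvol, volume_unitCube])
      measurableSet_unitCube.nullMeasurableSet (by simp [hvol])
    rw [hvD]
    exact fun y hy j => ⟨(hy j).1.le, (hy j).2⟩
  have hinv : ∀ (g : Submodule.span ℤ (range b)) (x), f (g +ᵥ x) = f x := by
    intro g x
    have hg : ∃ z : Fin N → ℤ,
        (g : EuclideanSpace ℝ (Fin N)) = WithLp.toLp 2 fun j => (z j : ℝ) := by
      have := (b.mem_span_iff_repr_mem ℤ _).1 g.2
      choose z hz using this
      refine ⟨z, ?_⟩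
      ext j
      simpa [b] using (hz j).symm
    obtain ⟨z, hz⟩ := hg
    rw [Submodule.vadd_def, vadd_eq_add, hz, add_comm]
    exact hf x z
  have h1 : ∫ t in unitCube N, f (s + t) = ∫ t in (v +ᵥ D : Set _), f (s + t) :=
    setIntegral_congr_set hQ
  have h2 : ∫ t in unitCube N, f t = ∫ t in (v +ᵥ D : Set _), f t := setIntegral_congr_set hQ
  have h3 : ∫ t in (v +ᵥ D : Set _), f (s + t) = ∫ t in (s +ᵥ (v +ᵥ D) : Set _), f t := by
    have := (measurePreserving_add_left volume s).setIntegral_preimage_emb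
      (MeasurableEquiv.addLeft s).measurableEmbedding f (s +ᵥ (v +ᵥ D))
    rw [← this]
    congr 2
    ext y
    simp [mem_vadd_set_iff_neg_vadd_mem]
  have : VAddInvariantMeasure (Submodule.span ℤ (range b)) (EuclideanSpace ℝ (Fin N)) volume :=
    inferInstanceAs (VAddInvariantMeasure (Submodule.span ℤ (range b)).toAddSubgroup _ volume)
  rw [h1, h2, h3]
  exact ((hD.vadd_of_comm v).vadd_of_comm s).setIntegral_eq (hD.vadd_of_comm v) hinv

theorem LatticePeriodic.comp {α β : Type*} {f : EuclideanSpace ℝ (Fin N) → α}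
    (hf : LatticePeriodic f) (g : α → β) : LatticePeriodic fun x => g (f x) :=
  fun x z => congrArg g (hf x z)

theorem latticePeriodic_cellPart : LatticePeriodic (cellPart (N := N)) := by
  intro x z
  ext j
  simp [cellPart]

theorem cellPart_eq_self {x : EuclideanSpace ℝ (Fin N)} (hx : x ∈ unitCube N) :
    cellPart x = x := by
  ext j
  have : round (x j) = 0 := by
    rw [round_eq_zero_iff]
    exact ⟨by have := (hx j).1; linarith, (hx j).2⟩
  simp [cellPart, this]

theorem cellPart_mem (x : EuclideanSpace ℝ (Fin N)) (j : Fin N) :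
    |cellPart x j| ≤ 1 / 2 := by
  simpa [cellPart] using abs_sub_round (x j)

theorem exists_add_int_eq_cellPart (x : EuclideanSpace ℝ (Fin N)) :
    ∃ z : Fin N → ℤ, x + (WithLp.toLp 2 fun j => (z j : ℝ)) = cellPart x :=
  ⟨fun j => -round (x j), by ext j; simp [cellPart, sub_eq_add_neg]⟩

theorem measurable_cellPart : Measurable (cellPart (N := N)) := by
  refine (WithLp.measurable_toLp 2 (Fin N → ℝ)).comp (measurable_pi_lambda _ fun j => ?_)
  have h : Measurable fun r : ℝ => (round r : ℝ) := by
    simp only [round_eq]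
    exact (measurable_from_top (f := fun n : ℤ => (n : ℝ))).comp
      (Int.measurable_floor.comp (measurable_id.add_const _))
  exact ((by fun_prop : Measurable fun x : EuclideanSpace ℝ (Fin N) => x j)).sub
    (h.comp (by fun_prop))

/-- A continuous periodic function is bounded. -/
theorem LatticePeriodic.exists_norm_le {E : Type*} [NormedAddCommGroup E]
    {f : EuclideanSpace ℝ (Fin N) → E} (hf : LatticePeriodic f) (hc : Continuous f) :
    ∃ C, ∀ x, ‖f x‖ ≤ C := by
  obtain ⟨C, hC⟩ := (isCompact_closedBall (0 : EuclideanSpace ℝ (Fin N))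
    (Real.sqrt N)).exists_bound_of_continuousOn hc.continuousOn
  refine ⟨C, fun x => ?_⟩
  obtain ⟨z, hz⟩ := exists_add_int_eq_cellPart x
  rw [← hf x z, hz]
  refine hC _ ?_
  rw [mem_closedBall_zero_iff, EuclideanSpace.norm_eq]
  refine Real.sqrt_le_sqrt ?_
  calc ∑ j, ‖cellPart x j‖ ^ 2 ≤ ∑ _j : Fin N, (1 : ℝ) := by
        refine Finset.sum_le_sum fun j _ => ?_
        have := cellPart_mem x j
        rw [Real.norm_eq_abs]
        nlinarith [abs_nonneg (cellPart x j)]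
    _ = N := by simp

theorem volume_slab (hN : 1 ≤ N) {t : ℝ} (ht0 : 0 ≤ t) (ht1 : t ≤ 1) :
    (volume.restrict (unitCube N)).real
      {x : EuclideanSpace ℝ (Fin N) | cellPart x ⟨0, hN⟩ < t - 1 / 2} = t := by
  have hS : MeasurableSet {x : EuclideanSpace ℝ (Fin N) | cellPart x ⟨0, hN⟩ < t - 1 / 2} :=
    measurableSet_lt ((by fun_prop : Measurable fun y : EuclideanSpace ℝ (Fin N) =>
      y ⟨0, hN⟩).comp measurable_cellPart) measurable_const
  have h : {x : EuclideanSpace ℝ (Fin N) | cellPart x ⟨0, hN⟩ < t - 1 / 2} ∩ unitCube N =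
      {y | ∀ j, y j ∈ Ioo (-(1 / 2) : ℝ) (if j = ⟨0, hN⟩ then t - 1 / 2 else 1 / 2)} := by
    ext y
    constructor
    · rintro ⟨h1, h2⟩ j
      rw [mem_ofPred, cellPart_eq_self h2] at h1
      split_ifs with hj
      · exact ⟨(h2 j).1, hj ▸ h1⟩
      · exact h2 j
    · intro h
      have h2 : y ∈ unitCube N := by
        intro j
        have := h j
        split_ifs at this with hj
        · exact ⟨this.1, by have := this.2; linarith⟩
        · exact this
      refine ⟨?_, h2⟩
      rw [mem_ofPred, cellPart_eq_self h2]
      have := (h ⟨0, hN⟩).2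
      simpa using this
  rw [measureReal_restrict_apply hS, h, measureReal_def, volume_euclidean_pi,
    Finset.prod_eq_single ⟨0, hN⟩]
  · simp only [if_true, Real.volume_Ioo]
    rw [ENNReal.toReal_ofReal (by linarith)]
    ring
  · intro j _ hj
    simp only [if_neg hj, Real.volume_Ioo]
    norm_num
  · simp

end Cube

/-! ### Weak convergence of rapidly oscillating periodic functions -/

section Oscillation

variable {N : ℕ} {E : Type*} [NormedAddCommGroup E]

/-- Translations act continuously on `L¹`. -/
theorem continuous_integral_norm_translate_sub {g : EuclideanSpace ℝ (Fin N) → E}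
    (hg : Integrable g) : Continuous fun s => ∫ x, ‖g (s + x) - g x‖ := by
  have hm : MemLp g 1 volume := memLp_one_iff_integrable.2 hg
  have : Fact ((1 : ℝ≥0∞) ≠ ⊤) := ⟨ENNReal.one_ne_top⟩
  have hc : Continuous fun s : EuclideanSpace ℝ (Fin N) =>
      ‖(DomAddAct.mk s +ᵥ hm.toLp g) - hm.toLp g‖ :=
    (((DomAddAct.continuous_mk).vadd continuous_const).sub continuous_const).norm
  simp only [DomAddAct.mk_vadd_toLp, ← MemLp.toLp_sub] at hc
  have key : ∀ s : EuclideanSpace ℝ (Fin N), ∀ h : MemLp ((fun x => g (s +ᵥ x)) - g) 1 volume,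
      ‖h.toLp _‖ = ∫ x, ‖g (s + x) - g x‖ := by
    intro s h
    have h' := integral_norm_eq_lintegral_enorm (h.1)
    rw [Lp.norm_toLp, eLpNorm_one_eq_lintegral_enorm, ← h']
    rfl
  simpa only [key] using hc

variable [NormedSpace ℝ E] [CompleteSpace E]

/-- A rapidly oscillating periodic function converges weakly to its mean. Averaging over
translations by less than one period replaces the oscillating factor by its mean, and changes the
other factor by little, because translations are continuous in `L¹`. -/
theorem tendsto_integral_oscillating {f : EuclideanSpace ℝ (Fin N) → ℝ} (hf : Measurable f)
    (hper : LatticePeriodic f) {C : ℝ} (hC : ∀ x, |f x| ≤ C)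
    {g : EuclideanSpace ℝ (Fin N) → E} (hg : Integrable g)
    {δ : ℕ → ℝ} (hδ : ∀ n, 0 < δ n) (hδ0 : Tendsto δ atTop (𝓝 0)) :
    Tendsto (fun n => ∫ x, f ((δ n)⁻¹ • x) • g x) atTop
      (𝓝 ((∫ y in unitCube N, f y) • ∫ x, g x)) := by
  set Q := unitCube N
  have hgt : ∀ s, Integrable fun x => g (s + x) := fun s => hg.comp_add_left s
  -- averaging over translations by `δ t`, `t ∈ Q`
  have hshift : ∀ n t, ∫ x, f ((δ n)⁻¹ • x) • g x = ∫ x, f ((δ n)⁻¹ • x + t) • g (δ n • t + x) := by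
    intro n t
    rw [← integral_add_left_eq_self (fun x => f ((δ n)⁻¹ • x) • g x) (δ n • t)]
    congr 1
    ext x
    rw [smul_add, smul_smul, inv_mul_cancel₀ (hδ n).ne', one_smul, add_comm t]
  have hbd : ∀ n t, Integrable fun x => f ((δ n)⁻¹ • x + t) • g x := fun n t =>
    hg.bdd_smul C ((by fun_prop : Measurable fun x => f ((δ n)⁻¹ • x + t))).aestronglyMeasurable
      (ae_of_all _ fun x => hC _)
  have hbd' : ∀ n t, Integrable fun x => f ((δ n)⁻¹ • x + t) • g (δ n • t + x) := fun n t =>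
    (hgt _).bdd_smul C ((by fun_prop : Measurable fun x => f ((δ n)⁻¹ • x + t))).aestronglyMeasurable
      (ae_of_all _ fun x => hC _)
  have hmean : ∀ n, ∫ t in Q, ∫ x, f ((δ n)⁻¹ • x + t) • g x =
      (∫ y in Q, f y) • ∫ x, g x := by
    intro n
    rw [integral_integral_swap]
    · rw [← integral_smul]
      congr 1
      ext x
      rw [integral_smul_const, hper.setIntegral_add]
    · refine Integrable.bdd_smul (C := C) (f := fun z : EuclideanSpace ℝ (Fin N) ×
        EuclideanSpace ℝ (Fin N) => g z.2) (hg.comp_snd _) ?_ ?_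
      · exact Measurable.aestronglyMeasurable (by fun_prop)
      · exact ae_of_all _ fun x => hC _
  have hmean_int : ∀ n, IntegrableOn (fun t => ∫ x, f ((δ n)⁻¹ • x + t) • g x) Q := by
    intro n
    refine Integrable.integral_prod_left (f := fun z : EuclideanSpace ℝ (Fin N) ×
        EuclideanSpace ℝ (Fin N) => f ((δ n)⁻¹ • z.2 + z.1) • g z.2) ?_
    refine Integrable.bdd_smul (C := C) (f := fun z : EuclideanSpace ℝ (Fin N) ×
        EuclideanSpace ℝ (Fin N) => g z.2) (hg.comp_snd _) ?_ ?_
    · exact Measurable.aestronglyMeasurable (by fun_prop)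
    · exact ae_of_all _ fun x => hC _
  have hC0 : 0 ≤ C := (abs_nonneg _).trans (hC 0)
  set ψ : EuclideanSpace ℝ (Fin N) → ℝ := fun s => ∫ x, ‖g (s + x) - g x‖ with hψ
  have hψc : Continuous ψ := continuous_integral_norm_translate_sub hg
  have hψ0 : ψ 0 = 0 := by simp [hψ]
  have hψb : ∀ s, |ψ s| ≤ 2 * ∫ x, ‖g x‖ := by
    intro s
    rw [abs_of_nonneg (integral_nonneg fun x => norm_nonneg _)]
    calc ψ s ≤ ∫ x, (‖g (s + x)‖ + ‖g x‖) :=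
          integral_mono ((hgt s).sub hg).norm ((hgt s).norm.add hg.norm) fun x => norm_sub_le _ _
      _ = 2 * ∫ x, ‖g x‖ := by
          rw [integral_add (hgt s).norm hg.norm, integral_add_left_eq_self (fun x => ‖g x‖)]
          ring
  have hψi : ∀ n, IntegrableOn (fun t => C * ψ (δ n • t)) Q := fun n =>
    (Integrable.of_bound (hψc.comp (by fun_prop)).aestronglyMeasurable (2 * ∫ x, ‖g x‖)
      (ae_of_all _ fun t => hψb _)).const_mul C
  have hdiff : ∀ n, ‖(∫ x, f ((δ n)⁻¹ • x) • g x) - (∫ y in Q, f y) • ∫ x, g x‖ ≤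
      ∫ t in Q, C * ψ (δ n • t) := by
    intro n
    have h1 : (∫ x, f ((δ n)⁻¹ • x) • g x) =
        ∫ t in Q, ∫ x, f ((δ n)⁻¹ • x + t) • g (δ n • t + x) := by
      simp only [← hshift n, integral_const, probReal_univ, one_smul, Q]
    have h1i : IntegrableOn (fun t => ∫ x, f ((δ n)⁻¹ • x + t) • g (δ n • t + x)) Q := by
      simp only [← hshift n]
      exact integrable_const _
    rw [h1, ← hmean n, ← integral_sub h1i (hmean_int n)]
    refine norm_integral_le_of_norm_le (hψi n) (ae_of_all _ fun t => ?_)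
    rw [← integral_sub (hbd' n t) (hbd n t), ← integral_const_mul]
    refine norm_integral_le_of_norm_le (((hgt _).sub hg).norm.const_mul C)
      (ae_of_all _ fun x => ?_)
    rw [← smul_sub, norm_smul]
    exact mul_le_mul_of_nonneg_right (hC _) (norm_nonneg _)
  have hlim : Tendsto (fun n => ∫ t in Q, C * ψ (δ n • t)) atTop (𝓝 (∫ _t in Q, (0 : ℝ))) := by
    refine tendsto_integral_of_dominated_convergence (fun _ => C * (2 * ∫ x, ‖g x‖))
      (fun n => (hψi n).1) (integrable_const _)
      (fun n => ae_of_all _ fun t => ?_) (ae_of_all _ fun t => ?_)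
    · rw [Real.norm_eq_abs, abs_mul, abs_of_nonneg hC0]
      exact mul_le_mul_of_nonneg_left (hψb _) hC0
    · have h0 : Tendsto (fun n => δ n • t) atTop (𝓝 0) := by
        simpa using hδ0.smul_const t
      simpa [hψ0] using ((hψc.tendsto 0).comp h0).const_mul C
  rw [integral_zero] at hlim
  exact tendsto_iff_norm_sub_tendsto_zero.2
    (squeeze_zero (fun n => norm_nonneg _) hdiff hlim)

end Oscillation

/-! ### Measurable selection of almost optimal values -/

open Classical in
/-- The index of the largest among `F 0 x, …, F m x`. -/
noncomputable def argmaxIndex {X : Type*} (F : ℕ → X → ℝ) : ℕ → X → ℕ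
  | 0, _ => 0
  | m + 1, x =>
    if F (argmaxIndex F m x) x < F (m + 1) x then m + 1 else argmaxIndex F m x

section Selection

variable {X : Type*} {F : ℕ → X → ℝ}

theorem argmaxIndex_le (m : ℕ) (x : X) : argmaxIndex F m x ≤ m := by
  induction m with
  | zero => simp [argmaxIndex]
  | succ m ih => rw [argmaxIndex]; split_ifs <;> lia

theorem le_argmaxIndex {l m : ℕ} (h : l ≤ m) (x : X) : F l x ≤ F (argmaxIndex F m x) x := by
  induction m with
  | zero => simp [argmaxIndex, Nat.le_zero.1 h]
  | succ m ih =>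
    rw [argmaxIndex]
    rcases Nat.of_le_succ h with h | rfl
    · have := ih h
      split_ifs with hc
      · exact this.trans hc.le
      · exact this
    · split_ifs with hc
      · exact le_rfl
      · exact not_lt.1 hc

theorem measurable_apply_index [MeasurableSpace X] {α : Type*} [MeasurableSpace α]
    {G : ℕ → X → α} (hG : ∀ l, Measurable (G l)) {s : X → ℕ} (hs : Measurable s) :
    Measurable fun x => G (s x) x :=
  (measurable_from_prod_countable_right (f := fun z : ℕ × X => G z.1 z.2) hG).comp
    (hs.prodMk measurable_id)

theorem measurable_argmaxIndex [MeasurableSpace X] (hF : ∀ l, Measurable (F l)) (m : ℕ) :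
    Measurable (argmaxIndex F m) := by
  induction m with
  | zero => exact measurable_const
  | succ m ih =>
    have : MeasurableSet {x | F (argmaxIndex F m x) x < F (m + 1) x} :=
      measurableSet_lt (measurable_apply_index hF ih) (hF _)
    exact Measurable.ite this measurable_const ih

/-- The integral of the supremum of a sequence of functions is approximated by choosing one of
finitely many members of the sequence at each point in a measurable way. -/
theorem exists_measurable_selection [MeasurableSpace X] {μ : Measure X}
    (hF : ∀ l, Measurable (F l)) (hFi : ∀ l, Integrable (F l) μ) {f : X → ℝ}
    (hf : Integrable f μ) (hlub : ∀ x, IsLUB (range fun l => F l x) (f x)) {η : ℝ} (hη : 0 < η) :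
    ∃ (s : X → ℕ) (m : ℕ), Measurable s ∧ (∀ x, s x ≤ m) ∧
      Integrable (fun x => F (s x) x) μ ∧ ∫ x, f x ∂μ - η ≤ ∫ x, F (s x) x ∂μ := by
  have hmeas : ∀ m, Measurable fun x => F (argmaxIndex F m x) x := fun m =>
    measurable_apply_index hF (measurable_argmaxIndex hF m)
  have hle : ∀ l x, F l x ≤ f x := fun l x => (hlub x).1 ⟨l, rfl⟩
  have hbd : ∀ m x, ‖F (argmaxIndex F m x) x‖ ≤ ‖F 0 x‖ + ‖f x‖ := by
    intro m x
    have h1 := le_argmaxIndex (F := F) (Nat.zero_le m) x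
    have h2 := hle (argmaxIndex F m x) x
    simp only [Real.norm_eq_abs]
    refine abs_le.2 ⟨?_, ?_⟩
    · linarith [neg_abs_le (F 0 x), abs_nonneg (f x)]
    · linarith [le_abs_self (f x), abs_nonneg (F 0 x)]
  have hint : ∀ m, Integrable (fun x => F (argmaxIndex F m x) x) μ := fun m =>
    ((hFi 0).norm.add hf.norm).mono' (hmeas m).aestronglyMeasurable (ae_of_all _ (hbd m))
  have hlim : Tendsto (fun m => ∫ x, F (argmaxIndex F m x) x ∂μ) atTop (𝓝 (∫ x, f x ∂μ)) := by
    refine tendsto_integral_of_dominated_convergence _ (fun m => (hint m).1)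
      ((hFi 0).norm.add hf.norm) (fun m => ae_of_all _ (hbd m)) (ae_of_all _ fun x => ?_)
    refine tendsto_order.2 ⟨fun r hr => ?_, fun r hr => ?_⟩
    · obtain ⟨_, ⟨l, rfl⟩, hl⟩ := (lt_isLUB_iff (hlub x)).1 hr
      filter_upwards [eventually_ge_atTop l] with m hm
      exact hl.trans_le (le_argmaxIndex hm x)
    · exact Eventually.of_forall fun m => (hle _ x).trans_lt hr
  obtain ⟨m, hm⟩ := (hlim.eventually (lt_mem_nhds (sub_lt_self _ hη))).exists
  exact ⟨argmaxIndex F m, m, measurable_argmaxIndex hF m, argmaxIndex_le m, hint m, hm.le⟩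

theorem integral_apply_index [MeasurableSpace X] {μ : Measure X} {s : X → ℕ} {m : ℕ}
    (hs : Measurable s) (hm : ∀ x, s x ≤ m) (hFi : ∀ l, Integrable (F l) μ) :
    Integrable (fun x => F (s x) x) μ ∧
    ∫ x, F (s x) x ∂μ = ∑ l ∈ Finset.range (m + 1), ∫ x in s ⁻¹' {l}, F l x ∂μ := by
  have hset : ∀ l, MeasurableSet (s ⁻¹' {l}) := fun l => hs (measurableSet_singleton l)
  have h : (fun x => F (s x) x) =
      fun x => ∑ l ∈ Finset.range (m + 1), (s ⁻¹' {l}).indicator (F l) x := by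
    ext x
    rw [Finset.sum_eq_single (s x)]
    · simp
    · intro l _ hl
      exact indicator_of_notMem (fun h => hl h.symm) _
    · intro h
      exact absurd (Finset.mem_range.2 (Nat.lt_succ_of_le (hm x))) h
  constructor
  · rw [h]
    exact integrable_finsetSum _ fun l _ => (hFi l).indicator (hset l)
  · rw [h, integral_finsetSum _ fun l _ => (hFi l).indicator (hset l)]
    exact Finset.sum_congr rfl fun l _ => integral_indicator (hset l)

end Selection

/-! ### Lower semicontinuity by duality -/

/-- Lower semicontinuity of integral functionals under weak convergence. The integrands enter only
through the affine lower bounds `⟪d l, ·⟫ - K n l`, of which the part that does not depend on `u n`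
converges weakly. -/
theorem eventually_integral_le_of_affine_minorants {X P : Type*} [MeasurableSpace X]
    {μ : Measure X} [NormedAddCommGroup P] [InnerProductSpace ℝ P]
    [MeasurableSpace P] [BorelSpace P] [SecondCountableTopology P]
    {u : ℕ → X → P} {v : X → P} (hu : ∀ n, Integrable (u n) μ) (hv : Integrable v μ)
    (hvm : Measurable v)
    (hweak : ∀ ξ : X → P, Measurable ξ → (∃ C, ∀ x, ‖ξ x‖ ≤ C) →
      Tendsto (fun n => ∫ x, inner ℝ (ξ x) (u n x) ∂μ) atTop (𝓝 (∫ x, inner ℝ (ξ x) (v x) ∂μ)))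
    {d : ℕ → P} {K : ℕ → ℕ → X → ℝ} (hK : ∀ n l, Integrable (K n l) μ)
    {K' : ℕ → X → ℝ} (hK' : ∀ l, Integrable (K' l) μ) (hK'm : ∀ l, Measurable (K' l))
    (hKlim : ∀ l A, MeasurableSet A →
      Tendsto (fun n => ∫ x in A, K n l x ∂μ) atTop (𝓝 (∫ x in A, K' l x ∂μ)))
    {V : ℕ → X → ℝ} (hV : ∀ n, Integrable (V n) μ)
    (hle : ∀ n, ∀ᵐ x ∂μ, ∀ l, inner ℝ (d l) (u n x) - K n l x ≤ V n x)
    {f : X → ℝ} (hf : Integrable f μ)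
    (hlub : ∀ x, IsLUB (range fun l => inner ℝ (d l) (v x) - K' l x) (f x))
    {η : ℝ} (hη : 0 < η) :
    ∀ᶠ n in atTop, ∫ x, f x ∂μ - η ≤ ∫ x, V n x ∂μ := by
  obtain ⟨s, m, hs, hm, -, hopt⟩ := exists_measurable_selection
    (F := fun l x => inner ℝ (d l) (v x) - K' l x)
    (fun l => (measurable_const.inner hvm).sub (hK'm l))
    (fun l => (hv.const_inner (d l)).sub (hK' l)) hf hlub (half_pos hη)
  have hξm : Measurable fun x => d (s x) := measurable_from_top.comp hs
  have hξb : ∃ C, ∀ x, ‖d (s x)‖ ≤ C := by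
    refine ⟨∑ l ∈ Finset.range (m + 1), ‖d l‖, fun x => ?_⟩
    exact Finset.single_le_sum (f := fun l => ‖d l‖) (fun l _ => norm_nonneg _)
      (Finset.mem_range.2 (Nat.lt_succ_of_le (hm x)))
  have hinn : ∀ w : X → P, Integrable w μ → Integrable (fun x => inner ℝ (d (s x)) (w x)) μ :=
    fun w hw => (integral_apply_index hs hm fun l => hw.const_inner (d l)).1
  have hlim : Tendsto (fun n => ∫ x, (inner ℝ (d (s x)) (u n x) - K n (s x) x) ∂μ) atTop
      (𝓝 (∫ x, (inner ℝ (d (s x)) (v x) - K' (s x) x) ∂μ)) := by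
    have h1 : ∀ n, ∫ x, (inner ℝ (d (s x)) (u n x) - K n (s x) x) ∂μ =
        ∫ x, inner ℝ (d (s x)) (u n x) ∂μ -
          ∑ l ∈ Finset.range (m + 1), ∫ x in s ⁻¹' {l}, K n l x ∂μ := fun n => by
      rw [integral_sub (hinn _ (hu n)) (integral_apply_index hs hm (hK n)).1,
        (integral_apply_index hs hm (hK n)).2]
    simp only [h1]
    rw [integral_sub (hinn _ hv) (integral_apply_index hs hm hK').1,
        (integral_apply_index hs hm hK').2]
    exact (hweak _ hξm hξb).sub
      (tendsto_finsetSum _ fun l _ => hKlim l _ (hs (measurableSet_singleton l)))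
  filter_upwards [hlim.eventually (lt_mem_nhds (sub_lt_self _ (half_pos hη)))] with n hn
  have h2 : ∫ x, (inner ℝ (d (s x)) (u n x) - K n (s x) x) ∂μ ≤ ∫ x, V n x ∂μ :=
    integral_mono_ae ((hinn _ (hu n)).sub (integral_apply_index hs hm (hK n)).1) (hV n)
      ((hle n).mono fun x hx => hx _)
  linarith

/-! ### Weak convergence in Hilbert spaces -/

section Hilbert

variable {H : Type*} [NormedAddCommGroup H] [InnerProductSpace ℝ H]

theorem tendsto_inner_of_dense {u : ℕ → H} {v : H} {R : ℝ} (hu : ∀ᶠ n in atTop, ‖u n‖ ≤ R)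
    {s : Set H} (hs : Dense s)
    (h : ∀ e ∈ s, Tendsto (fun n => inner ℝ (u n) e) atTop (𝓝 (inner ℝ v e))) (e : H) :
    Tendsto (fun n => inner ℝ (u n) e) atTop (𝓝 (inner ℝ v e)) := by
  rw [Metric.tendsto_atTop']
  intro η hη
  have hRv : 0 < |R| + ‖v‖ + 1 := by positivity
  obtain ⟨e', he', hd⟩ := hs.exists_dist_lt e (ε := η / 2 / (|R| + ‖v‖ + 1)) (by positivity)
  have h1 := (Metric.tendsto_atTop.1 (h e' he')) (η / 2) (by positivity)
  obtain ⟨n0, hn0⟩ := h1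
  obtain ⟨n1, hn1⟩ := eventually_atTop.1 hu
  refine ⟨max n0 n1, fun n hn => ?_⟩
  have h2 := hn0 n (by lia)
  have h3 := hn1 n (by lia)
  rw [Real.dist_eq] at h2 ⊢
  have h4 : inner ℝ (u n) e - inner ℝ v e =
      (inner ℝ (u n) e' - inner ℝ v e') + inner ℝ (u n - v) (e - e') := by
    simp only [inner_sub_left, inner_sub_right]; ring
  have h5 : |inner ℝ (u n - v) (e - e')| ≤ (|R| + ‖v‖ + 1) * ‖e - e'‖ := by
    refine (abs_real_inner_le_norm _ _).trans (mul_le_mul_of_nonneg_right ?_ (norm_nonneg _))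
    linarith [norm_sub_le (u n) v, le_abs_self R]
  have h6 : (|R| + ‖v‖ + 1) * ‖e - e'‖ < η / 2 := by
    rw [dist_eq_norm, lt_div_iff₀ hRv] at hd
    linarith
  rw [h4]
  linarith [abs_add_le (inner ℝ (u n) e' - inner ℝ v e') (inner ℝ (u n - v) (e - e'))]

variable [CompleteSpace H]

theorem tendsto_toWeakSpace_iff {u : ℕ → H} {v : H} :
    Tendsto (fun n => toWeakSpace ℝ H (u n)) atTop (𝓝 (toWeakSpace ℝ H v)) ↔
      ∀ e : H, Tendsto (fun n => inner ℝ (u n) e) atTop (𝓝 (inner ℝ v e)) := by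
  have hinj : Function.Injective (topDualPairing ℝ H).flip := by
    intro x y hxy
    refine ext_inner_left ℝ fun e => ?_
    exact congrArg (fun f => f (InnerProductSpace.toDual ℝ H e)) hxy
  refine (WeakBilin.tendsto_iff_forall_eval_tendsto (topDualPairing ℝ H).flip hinj).trans ?_
  constructor
  · intro h e
    simp only [real_inner_comm e]
    exact h (InnerProductSpace.toDual ℝ H e)
  · intro h f
    have := h ((InnerProductSpace.toDual ℝ H).symm f)
    simp only [real_inner_comm ((InnerProductSpace.toDual ℝ H).symm f),
      InnerProductSpace.toDual_symm_apply] at this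
    exact this

/-- Bounded sequences in a separable Hilbert space have weakly convergent subsequences. -/
theorem exists_subseq_tendsto_inner [TopologicalSpace.SeparableSpace H] {u : ℕ → H} {R : ℝ}
    (hu : ∀ n, ‖u n‖ ≤ R) :
    ∃ σ : ℕ → ℕ, StrictMono σ ∧ ∃ v : H,
      ∀ e : H, Tendsto (fun n => inner ℝ (u (σ n)) e) atTop (𝓝 (inner ℝ v e)) := by
  obtain ⟨f, -, σ, hσ, hf⟩ := WeakDual.isSeqCompact_closedBall ℝ H 0 R
    (x := fun n => StrongDual.toWeakDual (InnerProductSpace.toDual ℝ H (u n)))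
    (fun n => by simpa using hu n)
  refine ⟨σ, hσ, (InnerProductSpace.toDual ℝ H).symm (WeakDual.toStrongDual f), fun e => ?_⟩
  rw [InnerProductSpace.toDual_symm_apply]
  exact (WeakBilin.eval_continuous (topDualPairing ℝ H) e).tendsto f |>.comp hf

end Hilbert

/-- If each property `p m` holds eventually, then so does `p (σ n)` along some `σ` that tends to
infinity slowly enough. -/
theorem exists_diagonal {p : ℕ → ℕ → Prop} (h : ∀ m, ∀ᶠ n in atTop, p m n) :
    ∃ σ : ℕ → ℕ, Tendsto σ atTop atTop ∧ ∀ᶠ n in atTop, p (σ n) n := by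
  classical
  have hq : ∀ m, ∀ᶠ n in atTop, ∀ m' ≤ m, p m' n := fun m =>
    (Filter.eventually_all_finite (finite_le_nat m)).2 fun m' _ => h m'
  refine ⟨fun n => Nat.findGreatest (fun m => ∀ m' ≤ m, p m' n) n, ?_, ?_⟩
  · refine tendsto_atTop.2 fun m => ?_
    filter_upwards [hq m, eventually_ge_atTop m] with n h1 h2
    exact Nat.le_findGreatest h2 h1
  · filter_upwards [hq 0] with n hn
    exact Nat.findGreatest_spec (P := fun m => ∀ m' ≤ m, p m' n) (Nat.zero_le n) hn _ le_rfl

/-- Upper bounds for the `Γ`-limsup with respect to weak convergence need only be verified up to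
small errors, if the functionals are equicoercive. -/
theorem exists_recovery_of_approximate {H : Type*} [NormedAddCommGroup H] [InnerProductSpace ℝ H]
    [CompleteSpace H] [TopologicalSpace.SeparableSpace H] {G : ℕ → H → ℝ≥0∞} {L : ℝ≥0∞} {R : ℝ}
    (hR : ∀ n z, G n z ≤ L + 1 → ‖z‖ ≤ R) {v : H}
    (h : ∀ η : ℝ, 0 < η → ∃ v' : H, ‖v' - v‖ ≤ η ∧ ∃ u : ℕ → H,
      (∀ e, Tendsto (fun n => inner ℝ (u n) e) atTop (𝓝 (inner ℝ v' e))) ∧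
      ∀ᶠ n in atTop, G n (u n) ≤ L + ENNReal.ofReal η) :
    ∃ u : ℕ → H, (∀ e, Tendsto (fun n => inner ℝ (u n) e) atTop (𝓝 (inner ℝ v e))) ∧
      limsup (fun n => G n (u n)) atTop ≤ L := by
  have hηpos : ∀ m : ℕ, (0 : ℝ) < 1 / (m + 1) := fun m => by positivity
  choose v' hv' u hu hG using fun m : ℕ => h (1 / (m + 1)) (hηpos m)
  set d := TopologicalSpace.denseSeq H
  have hp : ∀ m, ∀ᶠ n in atTop, G n (u m n) ≤ L + ENNReal.ofReal (1 / (m + 1)) ∧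
      ∀ l ≤ m, |inner ℝ (u m n) (d l) - inner ℝ (v' m) (d l)| ≤ 1 / (m + 1) := by
    intro m
    refine (hG m).and ((Filter.eventually_all_finite (finite_le_nat m)).2 fun l _ => ?_)
    filter_upwards [Metric.tendsto_nhds.1 (hu m (d l)) _ (hηpos m)] with n hn
    exact (Real.dist_eq _ _ ▸ hn).le
  obtain ⟨σ, hσ, hσp⟩ := exists_diagonal hp
  have hz : Tendsto (fun n => (1 : ℝ) / (σ n + 1)) atTop (𝓝 0) :=
    tendsto_one_div_add_atTop_nhds_zero_nat.comp hσ
  refine ⟨fun n => u (σ n) n, ?_, ?_⟩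
  · refine tendsto_inner_of_dense (R := R) ?_ (TopologicalSpace.denseRange_denseSeq H) ?_
    · filter_upwards [hσp] with n hn
      refine hR n _ (hn.1.trans (add_le_add_right ?_ _))
      rw [← ENNReal.ofReal_one]
      refine ENNReal.ofReal_le_ofReal ?_
      rw [div_le_one (by positivity)]
      linarith [(Nat.cast_nonneg (σ n) : (0 : ℝ) ≤ σ n)]
    · rintro _ ⟨l, rfl⟩
      refine tendsto_iff_norm_sub_tendsto_zero.2 (squeeze_zero' (Eventually.of_forall fun n =>
        norm_nonneg _) ?_ (by simpa only [zero_mul] using hz.mul_const (1 + ‖d l‖)))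
      filter_upwards [hσp, hσ.eventually_ge_atTop l] with n hn hl
      have h1 := hn.2 l hl
      have h2 : |inner ℝ (v' (σ n) - v) (d l)| ≤ 1 / (σ n + 1) * ‖d l‖ :=
        (abs_real_inner_le_norm _ _).trans (mul_le_mul_of_nonneg_right (hv' _) (norm_nonneg _))
      rw [inner_sub_left] at h2
      rw [Real.norm_eq_abs]
      calc |inner ℝ (u (σ n) n) (d l) - inner ℝ v (d l)|
          ≤ |inner ℝ (u (σ n) n) (d l) - inner ℝ (v' (σ n)) (d l)| +
            |inner ℝ (v' (σ n)) (d l) - inner ℝ v (d l)| := abs_sub_le _ _ _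
        _ ≤ 1 / (σ n + 1) * (1 + ‖d l‖) := by linarith
  · have hlim : Tendsto (fun n => L + ENNReal.ofReal (1 / (σ n + 1))) atTop (𝓝 L) := by
      simpa using (ENNReal.tendsto_ofReal hz).const_add L
    calc limsup (fun n => G n (u (σ n) n)) atTop
        ≤ limsup (fun n => L + ENNReal.ofReal (1 / (σ n + 1))) atTop :=
          limsup_le_limsup (hσp.mono fun n hn => hn.1)
      _ = L := hlim.limsup_eq

/-! ### Legendre transforms of functions with quadratic growth -/

section Legendre

variable {P : Type*} [NormedAddCommGroup P]

/-- Two-sided quadratic growth, with constant `c`. -/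
structure HasQuadraticGrowth (c : ℝ) (f : P → ℝ) : Prop where
  lower : ∀ p, ‖p‖ ^ 2 / c - c ≤ f p
  upper : ∀ p, f p ≤ c * (1 + ‖p‖ ^ 2)

variable {c : ℝ} {f : P → ℝ}

theorem HasQuadraticGrowth.abs_le (hf : HasQuadraticGrowth c f) (hc : 0 < c) (p : P) :
    |f p| ≤ c * (1 + ‖p‖ ^ 2) := by
  have h1 := hf.lower p
  have h2 : 0 ≤ ‖p‖ ^ 2 / c := by positivity
  exact _root_.abs_le.2 ⟨by nlinarith [sq_nonneg ‖p‖], hf.upper p⟩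

variable [InnerProductSpace ℝ P]

/-- The convex conjugate of `f`. -/
noncomputable def legendre (f : P → ℝ) (ξ : P) : ℝ := ⨆ v, (inner ℝ ξ v - f v)

theorem HasQuadraticGrowth.inner_sub_le (hf : HasQuadraticGrowth c f) (hc : 0 < c) (ξ v : P) :
    inner ℝ ξ v - f v ≤ c * ‖ξ‖ ^ 2 / 4 + c := by
  have h1 := hf.lower v
  have h2 := real_inner_le_norm ξ v
  have h3 : ‖ξ‖ * ‖v‖ ≤ c * ‖ξ‖ ^ 2 / 4 + ‖v‖ ^ 2 / c := by
    have : 0 ≤ (c * ‖ξ‖ / 2 - ‖v‖) ^ 2 / c := by positivity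
    have h4 : (c * ‖ξ‖ / 2 - ‖v‖) ^ 2 / c = c * ‖ξ‖ ^ 2 / 4 - ‖ξ‖ * ‖v‖ + ‖v‖ ^ 2 / c := by
      field_simp
      ring
    linarith
  linarith

theorem HasQuadraticGrowth.isLUB_legendre (hf : HasQuadraticGrowth c f) (hc : 0 < c) (ξ : P) :
    IsLUB (range fun v => inner ℝ ξ v - f v) (legendre f ξ) :=
  isLUB_ciSup ⟨c * ‖ξ‖ ^ 2 / 4 + c, by rintro _ ⟨v, rfl⟩; exact hf.inner_sub_le hc ξ v⟩

theorem HasQuadraticGrowth.le_legendre (hf : HasQuadraticGrowth c f) (hc : 0 < c) (ξ v : P) :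
    inner ℝ ξ v - f v ≤ legendre f ξ :=
  (hf.isLUB_legendre hc ξ).1 ⟨v, rfl⟩

theorem legendre_le {ξ : P} {r : ℝ} (h : ∀ v, inner ℝ ξ v - f v ≤ r) : legendre f ξ ≤ r :=
  ciSup_le h

theorem HasQuadraticGrowth.legendre (hf : HasQuadraticGrowth c f) (hc : 0 < c) :
    HasQuadraticGrowth (4 * c) (legendre f) where
  lower ξ := by
    refine le_trans ?_ (hf.le_legendre hc ξ ((2 * c)⁻¹ • ξ))
    have h1 := hf.upper ((2 * c)⁻¹ • ξ)
    rw [norm_smul, Real.norm_of_nonneg (by positivity)] at h1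
    rw [inner_smul_right, real_inner_self_eq_norm_sq]
    have h2 : (2 * c)⁻¹ * ‖ξ‖ ^ 2 - c * (1 + ((2 * c)⁻¹ * ‖ξ‖) ^ 2) = ‖ξ‖ ^ 2 / (4 * c) - c := by
      field_simp
      ring
    linarith
  upper ξ := by
    refine legendre_le fun v => (hf.inner_sub_le hc ξ v).trans ?_
    nlinarith [mul_nonneg hc.le (sq_nonneg ‖ξ‖)]

theorem HasQuadraticGrowth.convexOn_legendre (hf : HasQuadraticGrowth c f) (hc : 0 < c) :
    ConvexOn ℝ univ (_root_.legendre f) := by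
  refine ⟨convex_univ, fun ξ _ ζ _ a b ha hb hab => legendre_le fun v => ?_⟩
  have h1 := mul_le_mul_of_nonneg_left (hf.le_legendre hc ξ v) ha
  have h2 := mul_le_mul_of_nonneg_left (hf.le_legendre hc ζ v) hb
  rw [inner_add_left, real_inner_smul_left, real_inner_smul_left, smul_eq_mul, smul_eq_mul]
  have h3 : f v = a * f v + b * f v := by rw [← add_mul, hab, one_mul]
  rw [h3]
  linarith

theorem continuous_of_convexOn [FiniteDimensional ℝ P] (hf : ConvexOn ℝ univ f) :
    Continuous f :=
  continuousOn_univ.1 (hf.continuousOn isOpen_univ)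

/-- Suprema of continuous functions may be taken over a dense sequence. -/
theorem isLUB_range_comp_of_denseRange {T : Type*} [TopologicalSpace T] {g : T → ℝ}
    (hg : Continuous g) {ι : Type*} {d : ι → T} (hd : DenseRange d) {r : ℝ}
    (h : IsLUB (range g) r) : IsLUB (range fun l => g (d l)) r := by
  refine ⟨by rintro _ ⟨l, rfl⟩; exact h.1 ⟨d l, rfl⟩, fun s hs => h.2 ?_⟩
  rintro _ ⟨v, rfl⟩
  exact hd.induction_on (p := fun v => g v ≤ s) v (isClosed_le hg continuous_const)
    fun l => hs ⟨l, rfl⟩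

theorem HasQuadraticGrowth.isLUB_legendre_dense (hf : HasQuadraticGrowth c f) (hc : 0 < c)
    (hcont : Continuous f) {d : ℕ → P} (hd : DenseRange d) (ξ : P) :
    IsLUB (range fun l => inner ℝ ξ (d l) - f (d l)) (_root_.legendre f ξ) :=
  isLUB_range_comp_of_denseRange (g := fun v => inner ℝ ξ v - f v)
    ((continuous_const.inner continuous_id).sub hcont) hd (hf.isLUB_legendre hc ξ)

theorem measurable_legendre_of_growth [FiniteDimensional ℝ P] {X : Type*} [MeasurableSpace X]
    {V : X → P → ℝ} (hc : 0 < c) (hm : ∀ p, Measurable fun x => V x p)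
    (hcont : ∀ x, Continuous (V x)) (hg : ∀ x, HasQuadraticGrowth c (V x)) (ξ : P) :
    Measurable fun x => _root_.legendre (V x) ξ :=
  Measurable.isLUB (f := fun l x => inner ℝ ξ (TopologicalSpace.denseSeq P l) -
    V x (TopologicalSpace.denseSeq P l)) (fun _ => measurable_const.sub (hm _))
    fun x => (hg x).isLUB_legendre_dense hc (hcont x)
      (TopologicalSpace.denseRange_denseSeq P) ξ

theorem HasQuadraticGrowth.legendre_legendre_nonneg (hf : HasQuadraticGrowth c f) (hc : 0 < c)
    (h0 : ∀ p, 0 ≤ f p) (p : P) : 0 ≤ _root_.legendre (_root_.legendre f) p := by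
  have h1 := (hf.legendre hc).le_legendre (by positivity) p 0
  have h2 : _root_.legendre f 0 ≤ 0 := legendre_le fun v => by simpa using h0 v
  rw [inner_zero_right] at h1
  linarith

theorem HasQuadraticGrowth.legendre_legendre_le (hf : HasQuadraticGrowth c f) (hc : 0 < c)
    (p : P) : _root_.legendre (_root_.legendre f) p ≤ f p :=
  legendre_le fun ξ => by
    have := hf.le_legendre hc ξ p
    rw [real_inner_comm]
    linarith

end Legendre

/-- A function of quadratic growth has its biconjugate as convex envelope. -/
theorem HasQuadraticGrowth.convexEnvelope_eq {M : ℕ} {c : ℝ} {f : EuclideanSpace ℝ (Fin M) → ℝ}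
    (hf : HasQuadraticGrowth c f) (hc : 0 < c) (p : EuclideanSpace ℝ (Fin M)) :
    convexEnvelope f p = _root_.legendre (_root_.legendre f) p := by
  have hf' := hf.legendre hc
  have hmem : _root_.legendre (_root_.legendre f) p ∈
      {t | ∃ g : EuclideanSpace ℝ (Fin M) → ℝ, ConvexOn ℝ univ g ∧ (∀ q, g q ≤ f q) ∧ g p = t} :=
    ⟨_, hf'.convexOn_legendre (by positivity), hf.legendre_legendre_le hc, rfl⟩
  refine le_antisymm (csSup_le ⟨_, hmem⟩ ?_) (le_csSup ?_ hmem)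
  · rintro _ ⟨g, hg, hgf, rfl⟩
    refine le_of_forall_lt fun r hr => ?_
    obtain ⟨r', hr', hr2⟩ := exists_between hr
    obtain ⟨l, b, hlb, hl⟩ := hg.exists_affine_le_of_lt (𝕜 := ℝ) (mem_univ p) hr2 isClosed_univ
      ((continuous_of_convexOn hg).lowerSemicontinuous.lowerSemicontinuousOn _)
    have hlb' : ∀ q, l q + b ≤ g q := fun q => hlb ⟨q, mem_univ q⟩
    have hl' : l p + b = r' := hl
    set ξ := (InnerProductSpace.toDual ℝ _).symm l
    have hξ : ∀ q, inner ℝ ξ q = l q := fun q => InnerProductSpace.toDual_symm_apply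
    have h1 : _root_.legendre f ξ ≤ -b := legendre_le fun v => by
      rw [hξ]; linarith [hlb' v, hgf v]
    have h2 := hf'.le_legendre (by positivity) p ξ
    rw [real_inner_comm, hξ] at h2
    linarith
  · exact ⟨f p, by rintro _ ⟨g, -, hgf, rfl⟩; exact hgf p⟩

/-! ### Periodic potentials of quadratic growth -/

/-- Nonnegative periodic Carathéodory functions with two-sided quadratic growth. -/
structure IsPeriodicPotential {N : ℕ} {P : Type*} [NormedAddCommGroup P] [InnerProductSpace ℝ P]
    (c : ℝ) (V : EuclideanSpace ℝ (Fin N) → P → ℝ) : Prop where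
  pos : 0 < c
  measurable : ∀ p, Measurable fun x => V x p
  continuous : ∀ x, Continuous (V x)
  periodic : LatticePeriodic V
  nonneg : ∀ x p, 0 ≤ V x p
  growth : ∀ x, HasQuadraticGrowth c (V x)

/-- The mean of the conjugates of `V y` over the unit cube. Its conjugate is the homogenized
potential. -/
noncomputable def meanConjugate {N : ℕ} {P : Type*} [NormedAddCommGroup P] [InnerProductSpace ℝ P]
    (V : EuclideanSpace ℝ (Fin N) → P → ℝ) (ξ : P) : ℝ :=
  ∫ y in unitCube N, legendre (V y) ξ

namespace IsPeriodicPotential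

variable {N : ℕ} {P : Type*} [NormedAddCommGroup P] [InnerProductSpace ℝ P]
  {c : ℝ} {V : EuclideanSpace ℝ (Fin N) → P → ℝ}

theorem four_mul_pos (hV : IsPeriodicPotential c V) : 0 < 4 * c := by
  have := hV.pos
  positivity

theorem abs_legendre_le (hV : IsPeriodicPotential c V) (ξ : P) (x) :
    |legendre (V x) ξ| ≤ 4 * c * (1 + ‖ξ‖ ^ 2) :=
  ((hV.growth x).legendre hV.pos).abs_le (by have := hV.pos; positivity) ξ

theorem latticePeriodic_legendre (hV : IsPeriodicPotential c V) (ξ : P) :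
    LatticePeriodic fun x => legendre (V x) ξ :=
  hV.periodic.comp fun f => legendre f ξ

variable [FiniteDimensional ℝ P]

theorem measurable_legendre (hV : IsPeriodicPotential c V) (ξ : P) :
    Measurable fun x => legendre (V x) ξ :=
  measurable_legendre_of_growth hV.pos hV.measurable hV.continuous hV.growth ξ

theorem integrable_legendre (hV : IsPeriodicPotential c V) {X : Type*} [MeasurableSpace X]
    {μ : Measure X} [IsFiniteMeasure μ] {φ : X → EuclideanSpace ℝ (Fin N)} (hφ : Measurable φ)
    (ξ : P) : Integrable (fun x => legendre (V (φ x)) ξ) μ :=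
  Integrable.of_bound ((hV.measurable_legendre ξ).comp hφ).aestronglyMeasurable _
    (ae_of_all _ fun x => hV.abs_legendre_le ξ (φ x))

theorem integrableOn_legendre (hV : IsPeriodicPotential c V) (ξ : P) :
    IntegrableOn (fun y => legendre (V y) ξ) (unitCube N) :=
  hV.integrable_legendre measurable_id ξ

theorem convexOn_meanConjugate (hV : IsPeriodicPotential c V) :
    ConvexOn ℝ univ (meanConjugate V) := by
  refine ⟨convex_univ, fun ξ _ ζ _ a b ha hb hab => ?_⟩
  have hi := hV.integrableOn_legendre
  simp only [meanConjugate, smul_eq_mul]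
  rw [← integral_const_mul, ← integral_const_mul, ← integral_add ((hi ξ).const_mul a)
    ((hi ζ).const_mul b)]
  exact integral_mono (hi _) (((hi ξ).const_mul a).add ((hi ζ).const_mul b)) fun y =>
    ((hV.growth y).convexOn_legendre hV.pos).2 (mem_univ ξ) (mem_univ ζ) ha hb hab

theorem growth_meanConjugate (hV : IsPeriodicPotential c V) :
    HasQuadraticGrowth (4 * c) (meanConjugate V) := by
  have hi := hV.integrableOn_legendre
  have hg := fun x => (hV.growth x).legendre hV.pos
  constructor <;> intro ξ
  · have := integral_mono (integrable_const _) (hi ξ) fun y => (hg y).lower ξ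
    simpa [meanConjugate, volume_unitCube] using this
  · have := integral_mono (hi ξ) (integrable_const _) fun y => (hg y).upper ξ
    simpa [meanConjugate, volume_unitCube] using this

theorem continuous_meanConjugate (hV : IsPeriodicPotential c V) :
    Continuous (meanConjugate V) :=
  continuous_of_convexOn hV.convexOn_meanConjugate

theorem growth_legendre_meanConjugate (hV : IsPeriodicPotential c V) :
    HasQuadraticGrowth (4 * (4 * c)) (legendre (meanConjugate V)) :=
  hV.growth_meanConjugate.legendre hV.four_mul_pos

theorem continuous_legendre_meanConjugate (hV : IsPeriodicPotential c V) :
    Continuous (legendre (meanConjugate V)) :=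
  continuous_of_convexOn (hV.growth_meanConjugate.convexOn_legendre hV.four_mul_pos)

theorem legendre_meanConjugate_nonneg (hV : IsPeriodicPotential c V) (p : P) :
    0 ≤ legendre (meanConjugate V) p := by
  have h1 := hV.growth_meanConjugate.le_legendre hV.four_mul_pos p 0
  have h2 : meanConjugate V 0 ≤ 0 := integral_nonpos fun y =>
    legendre_le fun v => by simpa using hV.nonneg y v
  rw [inner_zero_right] at h1
  linarith

/-- The easy inequality in the duality formula for the homogenized potential. -/
theorem legendre_meanConjugate_le (hV : IsPeriodicPotential c V)
    {w : EuclideanSpace ℝ (Fin N) → P} (hw : IntegrableOn w (unitCube N))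
    {F : EuclideanSpace ℝ (Fin N) → ℝ} (hF : IntegrableOn F (unitCube N))
    (hle : ∀ y ξ, inner ℝ ξ (w y) - legendre (V y) ξ ≤ F y) :
    legendre (meanConjugate V) (∫ y in unitCube N, w y) ≤ ∫ y in unitCube N, F y := by
  refine legendre_le fun ξ => ?_
  have hi := hV.integrableOn_legendre ξ
  rw [real_inner_comm, ← integral_inner hw, meanConjugate,
    ← integral_sub (hw.const_inner ξ) hi]
  exact integral_mono ((hw.const_inner ξ).sub hi) hF fun y => hle y ξ

theorem integrable_legendre_meanConjugate (hV : IsPeriodicPotential c V) {X : Type*}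
    [MeasurableSpace X] {μ : Measure X} [IsFiniteMeasure μ] {w : X → P} (hw : MemLp w 2 μ) :
    Integrable (fun x => legendre (meanConjugate V) (w x)) μ := by
  refine (((integrable_const (1 : ℝ)).add hw.integrable_norm_pow').const_mul (4 * (4 * c))).mono'
    (hV.continuous_legendre_meanConjugate.comp_aestronglyMeasurable hw.1)
    (ae_of_all _ fun x => ?_)
  exact hV.growth_legendre_meanConjugate.abs_le (by have := hV.pos; positivity) _

variable [MeasurableSpace P] [BorelSpace P]

theorem measurable_uncurry (hV : IsPeriodicPotential c V) :
    Measurable fun z : EuclideanSpace ℝ (Fin N) × P => V z.1 z.2 :=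
  (measurable_uncurry_of_continuous_of_measurable (u := fun p x => V x p) hV.continuous
    hV.measurable).comp measurable_swap

theorem integrable_comp (hV : IsPeriodicPotential c V) {X : Type*} [MeasurableSpace X]
    {μ : Measure X} [IsFiniteMeasure μ] {φ : X → EuclideanSpace ℝ (Fin N)} (hφ : Measurable φ)
    {w : X → P} (hw : MemLp w 2 μ) : Integrable (fun x => V (φ x) (w x)) μ := by
  refine (((integrable_const (1 : ℝ)).add hw.integrable_norm_pow').const_mul c).mono'
    (hV.measurable_uncurry.comp_aemeasurable
      (hφ.aemeasurable.prodMk hw.1.aemeasurable)).aestronglyMeasurable (ae_of_all _ fun x => ?_)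
  exact (hV.growth _).abs_le hV.pos _

end IsPeriodicPotential

/-! ### Duality formula for the homogenized potential -/

theorem memLp_of_measurable_of_bounded {X P : Type*} [MeasurableSpace X] {μ : Measure X}
    [IsFiniteMeasure μ] [NormedAddCommGroup P] [MeasurableSpace P] [BorelSpace P]
    [SecondCountableTopology P] {w : X → P} (hw : Measurable w) (hb : ∃ C, ∀ x, ‖w x‖ ≤ C)
    {p : ℝ≥0∞} : MemLp w p μ := by
  obtain ⟨C, hC⟩ := hb
  exact MemLp.of_bound hw.aestronglyMeasurable C (ae_of_all _ hC)

/-- The union of the lattice translates of a slab of the unit cube. -/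
def periodicSlab {N : ℕ} (hN : 1 ≤ N) (t : ℝ) : Set (EuclideanSpace ℝ (Fin N)) :=
  {x | cellPart x ⟨0, hN⟩ < t - 1 / 2}

section Mixing

variable {N : ℕ} (hN : 1 ≤ N)

theorem measurableSet_periodicSlab (t : ℝ) : MeasurableSet (periodicSlab hN t) :=
  measurableSet_lt ((by fun_prop : Measurable fun y : EuclideanSpace ℝ (Fin N) =>
    y ⟨0, hN⟩).comp measurable_cellPart) measurable_const

open Classical in
/-- Finely mixing two functions with volume fractions `t` and `1 - t` produces the corresponding
convex combination of their integrals. -/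
theorem tendsto_integral_mixture {E : Type*} [NormedAddCommGroup E] [NormedSpace ℝ E]
    [CompleteSpace E] {t : ℝ} (ht0 : 0 ≤ t) (ht1 : t ≤ 1) {g₁ g₂ : EuclideanSpace ℝ (Fin N) → E}
    (h₁ : IntegrableOn g₁ (unitCube N)) (h₂ : IntegrableOn g₂ (unitCube N)) :
    Tendsto (fun n : ℕ => ∫ y in unitCube N,
      if ((n : ℝ) + 1) • y ∈ periodicSlab hN t then g₁ y else g₂ y) atTop
      (𝓝 (t • (∫ y in unitCube N, g₁ y) + (1 - t) • ∫ y in unitCube N, g₂ y)) := by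
  set S := periodicSlab hN t
  have hS : MeasurableSet S := measurableSet_periodicSlab hN t
  set f : EuclideanSpace ℝ (Fin N) → ℝ := S.indicator 1
  have hfm : Measurable f := measurable_one.indicator hS
  have hfp : LatticePeriodic f := latticePeriodic_cellPart.comp
    ({x : EuclideanSpace ℝ (Fin N) | x ⟨0, hN⟩ < t - 1 / 2}.indicator 1)
  have hfb : ∀ x, |f x| ≤ 1 := fun x => by
    by_cases hx : x ∈ S <;> simp [f, hx]
  have hfi : ∫ y in unitCube N, f y = t := by
    rw [integral_indicator_one hS]
    exact volume_slab hN ht0 ht1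
  have hδ0 : Tendsto (fun n : ℕ => (1 : ℝ) / (n + 1)) atTop (𝓝 0) :=
    tendsto_one_div_add_atTop_nhds_zero_nat
  have hdi : IntegrableOn (fun y => g₁ y - g₂ y) (unitCube N) := h₁.sub h₂
  have key := tendsto_integral_oscillating hfm hfp hfb (hdi.integrable_indicator
    measurableSet_unitCube) (fun n => by positivity) hδ0
  rw [hfi, integral_indicator measurableSet_unitCube, integral_sub h₁ h₂] at key
  have h3 := key.const_add (∫ y in unitCube N, g₂ y)
  have h4 : (∫ y in unitCube N, g₂ y) +
      t • ((∫ y in unitCube N, g₁ y) - ∫ y in unitCube N, g₂ y) =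
      t • (∫ y in unitCube N, g₁ y) + (1 - t) • ∫ y in unitCube N, g₂ y := by
    rw [smul_sub, sub_smul, one_smul]; abel
  rw [h4] at h3
  refine h3.congr fun n => ?_
  have hind : ∀ y, f (((1 : ℝ) / (n + 1))⁻¹ • y) •
      (unitCube N).indicator (fun y => g₁ y - g₂ y) y = (unitCube N).indicator
        (fun y => f (((1 : ℝ) / (n + 1))⁻¹ • y) • (g₁ y - g₂ y)) y := fun y => by
    by_cases hy : y ∈ unitCube N <;> simp [hy]
  simp only [hind]
  rw [integral_indicator measurableSet_unitCube, ← integral_add h₂]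
  · refine integral_congr_ae (ae_of_all _ fun y => ?_)
    by_cases hy : ((n : ℝ) + 1) • y ∈ S <;> simp [f, hy]
  · exact hdi.bdd_smul 1 (hfm.comp (measurable_const_smul _)).aestronglyMeasurable
      (ae_of_all _ fun y => hfb _)

end Mixing

/-- The pairs formed by the mean of a bounded function and an upper bound for its energy. -/
def meanEnergySet {N : ℕ} {P : Type*} [NormedAddCommGroup P] [InnerProductSpace ℝ P]
    [MeasurableSpace P] (V : EuclideanSpace ℝ (Fin N) → P → ℝ) : Set (P × ℝ) :=
  {z | ∃ w : EuclideanSpace ℝ (Fin N) → P, Measurable w ∧ (∃ C, ∀ x, ‖w x‖ ≤ C) ∧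
    ∫ y in unitCube N, w y = z.1 ∧ ∫ y in unitCube N, V y (w y) ≤ z.2}

namespace IsPeriodicPotential

variable {N : ℕ} {P : Type*} [NormedAddCommGroup P] [InnerProductSpace ℝ P]
  [FiniteDimensional ℝ P] [MeasurableSpace P] [BorelSpace P]
  {c : ℝ} {V : EuclideanSpace ℝ (Fin N) → P → ℝ}

theorem integrableOn_comp (hV : IsPeriodicPotential c V) {w : EuclideanSpace ℝ (Fin N) → P}
    (hw : Measurable w) (hb : ∃ C, ∀ x, ‖w x‖ ≤ C) :
    IntegrableOn (fun y => V y (w y)) (unitCube N) :=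
  hV.integrable_comp measurable_id (memLp_of_measurable_of_bounded hw hb)

theorem combo_mem_closure_meanEnergySet (hV : IsPeriodicPotential c V) (hN : 1 ≤ N)
    {z₁ z₂ : P × ℝ} (h₁ : z₁ ∈ meanEnergySet V) (h₂ : z₂ ∈ meanEnergySet V) {a b : ℝ}
    (ha : 0 ≤ a) (hb : 0 ≤ b) (hab : a + b = 1) :
    a • z₁ + b • z₂ ∈ closure (meanEnergySet V) := by
  classical
  obtain ⟨w₁, hm₁, hb₁, hi₁, he₁⟩ := h₁
  obtain ⟨w₂, hm₂, hb₂, hi₂, he₂⟩ := h₂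
  obtain rfl : b = 1 - a := by linarith
  set w : ℕ → EuclideanSpace ℝ (Fin N) → P := fun n y =>
    if ((n : ℝ) + 1) • y ∈ periodicSlab hN a then w₁ y else w₂ y with hw
  have hwm : ∀ n, Measurable (w n) := fun n => Measurable.ite
    ((measurable_const_smul ((n : ℝ) + 1)) (measurableSet_periodicSlab hN a)) hm₁ hm₂
  have hwb : ∀ n, ∃ C, ∀ x, ‖w n x‖ ≤ C := by
    obtain ⟨C₁, hC₁⟩ := hb₁
    obtain ⟨C₂, hC₂⟩ := hb₂
    refine fun n => ⟨max C₁ C₂, fun x => ?_⟩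
    simp only [hw]
    split_ifs
    · exact (hC₁ x).trans (le_max_left _ _)
    · exact (hC₂ x).trans (le_max_right _ _)
  have l1 := tendsto_integral_mixture hN ha (by linarith)
    ((memLp_of_measurable_of_bounded hm₁ hb₁ (p := 1)).integrable le_rfl)
    ((memLp_of_measurable_of_bounded hm₂ hb₂ (p := 1)).integrable le_rfl)
  have l2 := tendsto_integral_mixture hN ha (by linarith) (hV.integrableOn_comp hm₁ hb₁)
    (hV.integrableOn_comp hm₂ hb₂)
  set s := a * (z₁.2 - ∫ y in unitCube N, V y (w₁ y)) +
    (1 - a) * (z₂.2 - ∫ y in unitCube N, V y (w₂ y))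
  have hs : 0 ≤ s := add_nonneg (mul_nonneg ha (by linarith)) (mul_nonneg hb (by linarith))
  refine mem_closure_of_tendsto (b := atTop) (f := fun n : ℕ => (∫ y in unitCube N, w n y,
    (∫ y in unitCube N, V y (w n y)) + s)) ?_ (Eventually.of_forall fun n =>
      ⟨w n, hwm n, hwb n, rfl, by simpa using hs⟩)
  have l3 : Tendsto (fun n => (∫ y in unitCube N, V y (w n y)) + s) atTop
      (𝓝 (a * z₁.2 + (1 - a) * z₂.2)) := by
    have := l2.add_const s
    simp only [smul_eq_mul] at this
    have e : a * (∫ y in unitCube N, V y (w₁ y)) + (1 - a) * (∫ y in unitCube N, V y (w₂ y)) + s =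
        a * z₁.2 + (1 - a) * z₂.2 := by simp only [s]; ring
    rw [e] at this
    refine this.congr fun n => ?_
    congr 2
    ext y
    simp only [hw]
    split_ifs <;> rfl
  rw [hi₁, hi₂] at l1
  exact l1.prodMk_nhds l3

theorem convex_closure_meanEnergySet (hV : IsPeriodicPotential c V) (hN : 1 ≤ N) :
    Convex ℝ (closure (meanEnergySet V)) := by
  intro z₁ h₁ z₂ h₂ a b ha hb hab
  rw [← closure_closure]
  exact map_mem_closure₂ (f := fun z₁ z₂ : P × ℝ => a • z₁ + b • z₂) (by fun_prop) h₁ h₂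
    fun z₁ h₁ z₂ h₂ => hV.combo_mem_closure_meanEnergySet hN h₁ h₂ ha hb hab

/-- The conjugate is attained, up to a small error, by a bounded measurable function. -/
theorem exists_near_meanConjugate (hV : IsPeriodicPotential c V) (ξ : P) {η : ℝ} (hη : 0 < η) :
    ∃ w : EuclideanSpace ℝ (Fin N) → P, Measurable w ∧ (∃ C, ∀ x, ‖w x‖ ≤ C) ∧
      meanConjugate V ξ - η ≤
        inner ℝ ξ (∫ y in unitCube N, w y) - ∫ y in unitCube N, V y (w y) := by
  set d := TopologicalSpace.denseSeq P
  obtain ⟨s, m, hs, hm, -, hopt⟩ := exists_measurable_selection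
    (μ := volume.restrict (unitCube N)) (F := fun l y => inner ℝ ξ (d l) - V y (d l))
    (fun l => measurable_const.sub (hV.measurable _))
    (fun l => (integrable_const _).sub
      (hV.integrableOn_comp measurable_const ⟨‖d l‖, fun _ => le_rfl⟩))
    (hV.integrableOn_legendre ξ)
    (fun y => (hV.growth y).isLUB_legendre_dense hV.pos (hV.continuous y)
      (TopologicalSpace.denseRange_denseSeq P) ξ) hη
  have hwm : Measurable fun y => d (s y) := measurable_from_top.comp hs
  have hwb : ∃ C, ∀ x, ‖d (s x)‖ ≤ C := by
    refine ⟨∑ l ∈ Finset.range (m + 1), ‖d l‖, fun x => ?_⟩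
    exact Finset.single_le_sum (f := fun l => ‖d l‖) (fun l _ => norm_nonneg _)
      (Finset.mem_range.2 (Nat.lt_succ_of_le (hm x)))
  have hwi : IntegrableOn (fun y => d (s y)) (unitCube N) :=
    (memLp_of_measurable_of_bounded hwm hwb (p := 1)).integrable le_rfl
  refine ⟨fun y => d (s y), hwm, hwb, ?_⟩
  rw [← integral_inner hwi, ← integral_sub (hwi.const_inner ξ) (hV.integrableOn_comp hwm hwb)]
  exact hopt

/-- The hard inequality in the duality formula for the homogenized potential: a point outside the
closure of `meanEnergySet V` would be separated from it by a hyperplane, which cannot be vertical,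
and the slope of the hyperplane contradicts the definition of the conjugate. -/
theorem mk_legendre_meanConjugate_mem_closure (hV : IsPeriodicPotential c V) (hN : 1 ≤ N) (p : P) :
    (p, legendre (meanConjugate V) p) ∈ closure (meanEnergySet V) := by
  by_contra hp
  obtain ⟨f, r, hfp, hf⟩ := geometric_hahn_banach_point_closed
    (hV.convex_closure_meanEnergySet hN) isClosed_closure hp
  set β := f (0, 1) with hβ
  set ζ := (InnerProductSpace.toDual ℝ P).symm (f.comp (ContinuousLinearMap.inl ℝ P ℝ)) with hζ
  have hfz : ∀ q e, f (q, e) = inner ℝ ζ q + e * β := by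
    intro q e
    have h1 : (q, e) = ((q, 0) : P × ℝ) + e • ((0, 1) : P × ℝ) := by simp
    rw [h1, map_add, map_smul, hζ, InnerProductSpace.toDual_symm_apply]
    rfl
  have hmem : ∀ w : EuclideanSpace ℝ (Fin N) → P, Measurable w → (∃ C, ∀ x, ‖w x‖ ≤ C) →
      ∀ e, 0 ≤ e → r < inner ℝ ζ (∫ y in unitCube N, w y) +
        ((∫ y in unitCube N, V y (w y)) + e) * β := by
    intro w hwm hwb e he
    rw [← hfz]
    exact hf _ (subset_closure ⟨w, hwm, hwb, rfl, by simpa using he⟩)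
  rw [hfz] at hfp
  have hconst := hmem (fun _ => p) measurable_const ⟨‖p‖, fun _ => le_rfl⟩
  simp only [integral_const, probReal_univ, one_smul] at hconst
  set A := ∫ y in unitCube N, V y p
  set L := legendre (meanConjugate V) p
  -- the energy component of the normal vector is positive
  have hβ0 : 0 < β := by
    by_contra hneg
    have hβ' : β ≤ 0 := not_lt.1 hneg
    have h1 := hconst (|L| + |A|) (by positivity)
    have h2 : (A + (|L| + |A|)) * β ≤ L * β :=
      mul_le_mul_of_nonpos_right (by linarith [le_abs_self L, neg_abs_le A]) hβ'
    linarith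
  set ξ := -β⁻¹ • ζ
  have hbound : ∀ η : ℝ, 0 < η → meanConjugate V ξ - η ≤ -(r / β) := by
    intro η hη
    obtain ⟨w, hwm, hwb, hw⟩ := hV.exists_near_meanConjugate ξ hη
    have h1 := hmem w hwm hwb 0 le_rfl
    have h2 : inner ℝ ξ (∫ y in unitCube N, w y) =
        -(inner ℝ ζ (∫ y in unitCube N, w y) / β) := by
      simp only [ξ, real_inner_smul_left]; ring
    have h3 : r / β < inner ℝ ζ (∫ y in unitCube N, w y) / β + ∫ y in unitCube N, V y (w y) := by
      rw [div_lt_iff₀ hβ0, add_mul, div_mul_cancel₀ _ hβ0.ne']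
      linarith
    linarith
  have h1 : meanConjugate V ξ ≤ -(r / β) :=
    le_of_forall_pos_sub_le hbound
  have h2 := hV.growth_meanConjugate.le_legendre hV.four_mul_pos p ξ
  have h3 : inner ℝ p ξ = -(inner ℝ ζ p / β) := by
    rw [real_inner_comm]
    simp only [ξ, real_inner_smul_left]; ring
  have h4 : inner ℝ ζ p / β + L < r / β := by
    rw [lt_div_iff₀ hβ0, add_mul, div_mul_cancel₀ _ hβ0.ne']
    linarith
  rw [h3] at h2
  linarith

theorem exists_near_legendre_meanConjugate (hV : IsPeriodicPotential c V) (hN : 1 ≤ N) (p : P)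
    {η : ℝ} (hη : 0 < η) :
    ∃ w : EuclideanSpace ℝ (Fin N) → P, Measurable w ∧ (∃ C, ∀ x, ‖w x‖ ≤ C) ∧
      ‖(∫ y in unitCube N, w y) - p‖ < η ∧
      ∫ y in unitCube N, V y (w y) < legendre (meanConjugate V) p + η := by
  obtain ⟨z, ⟨w, hwm, hwb, h1, h2⟩, hz⟩ := Metric.mem_closure_iff.1
    (hV.mk_legendre_meanConjugate_mem_closure hN p) η hη
  rw [Prod.dist_eq, max_lt_iff, dist_comm, dist_eq_norm, dist_comm _ z.2, Real.dist_eq] at hz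
  refine ⟨w, hwm, hwb, h1 ▸ hz.1, ?_⟩
  have := (abs_lt.1 hz.2).2
  linarith

end IsPeriodicPotential

/-! ### Attainment in the cell problem -/

section L2

variable {X P : Type*} [MeasurableSpace X] {μ : Measure X} [NormedAddCommGroup P]

theorem separableSpace_L2 [IsSeparable μ] [TopologicalSpace.SeparableSpace P] :
    TopologicalSpace.SeparableSpace (Lp P 2 μ) := by
  have : Fact ((2 : ℝ≥0∞) ≠ ⊤) := ⟨ENNReal.ofNat_ne_top⟩
  infer_instance

variable [InnerProductSpace ℝ P]

theorem L2_norm_sq_eq (u : Lp P 2 μ) : ‖u‖ ^ 2 = ∫ x, ‖u x‖ ^ 2 ∂μ := by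
  rw [← real_inner_self_eq_norm_sq, L2.inner_def]
  simp only [real_inner_self_eq_norm_sq]

theorem L2_inner_toLp {w : X → P} (hw : MemLp w 2 μ) (u : Lp P 2 μ) :
    inner ℝ (hw.toLp w) u = ∫ x, inner ℝ (w x) (u x) ∂μ := by
  rw [L2.inner_def]
  refine integral_congr_ae ?_
  filter_upwards [hw.coeFn_toLp] with x hx
  rw [hx]

theorem tendsto_integral_inner_of_weak [IsFiniteMeasure μ] [MeasurableSpace P] [BorelSpace P]
    [SecondCountableTopology P] {u : ℕ → Lp P 2 μ} {v : Lp P 2 μ}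
    (h : ∀ e : Lp P 2 μ, Tendsto (fun n => inner ℝ (u n) e) atTop (𝓝 (inner ℝ v e)))
    (ξ : X → P) (hξ : Measurable ξ) (hb : ∃ C, ∀ x, ‖ξ x‖ ≤ C) :
    Tendsto (fun n => ∫ x, inner ℝ (ξ x) (u n x) ∂μ) atTop
      (𝓝 (∫ x, inner ℝ (ξ x) (v x) ∂μ)) := by
  have hm : MemLp ξ 2 μ := memLp_of_measurable_of_bounded hξ hb
  have := h (hm.toLp ξ)
  simpa only [real_inner_comm (hm.toLp ξ), L2_inner_toLp] using this

end L2

namespace IsPeriodicPotential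

variable {N : ℕ} {P : Type*} [NormedAddCommGroup P] [InnerProductSpace ℝ P]
  [FiniteDimensional ℝ P] {c : ℝ} {V : EuclideanSpace ℝ (Fin N) → P → ℝ}

theorem biconjugate (hV : IsPeriodicPotential c V) :
    IsPeriodicPotential (4 * (4 * c)) fun x => legendre (legendre (V x)) where
  pos := by have := hV.pos; positivity
  measurable := measurable_legendre_of_growth hV.four_mul_pos hV.measurable_legendre
    (fun x => continuous_of_convexOn ((hV.growth x).convexOn_legendre hV.pos))
    fun x => (hV.growth x).legendre hV.pos
  continuous x := continuous_of_convexOn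
    (((hV.growth x).legendre hV.pos).convexOn_legendre hV.four_mul_pos)
  periodic := hV.periodic.comp fun f => legendre (legendre f)
  nonneg x := (hV.growth x).legendre_legendre_nonneg hV.pos (hV.nonneg x)
  growth x := ((hV.growth x).legendre hV.pos).legendre hV.four_mul_pos

variable [MeasurableSpace P] [BorelSpace P]

theorem norm_sq_le (hV : IsPeriodicPotential c V) {X : Type*} [MeasurableSpace X]
    {μ : Measure X} [IsFiniteMeasure μ] {φ : X → EuclideanSpace ℝ (Fin N)} (hφ : Measurable φ)
    (u : Lp P 2 μ) : ‖u‖ ^ 2 ≤ c * (∫ x, V (φ x) (u x) ∂μ + c * μ.real univ) := by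
  have hc := hV.pos
  have hi := hV.integrable_comp hφ (Lp.memLp u)
  rw [L2_norm_sq_eq]
  have h1 : ∫ x, ‖u x‖ ^ 2 ∂μ ≤ ∫ x, c * (V (φ x) (u x) + c) ∂μ := by
    refine integral_mono (Lp.memLp u).integrable_norm_pow'
      ((hi.add (integrable_const c)).const_mul c) fun x => ?_
    have := (hV.growth (φ x)).lower (u x)
    have h2 : ‖u x‖ ^ 2 / c ≤ V (φ x) (u x) + c := by linarith
    rw [div_le_iff₀ hc] at h2
    linarith
  rw [integral_const_mul, integral_add hi (integrable_const c), integral_const] at h1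
  simpa [mul_comm] using h1

/-- Weak limits of almost optimal competitors are optimal for the convexified cell problem. -/
theorem exists_memLp_biconjugate_le (hV : IsPeriodicPotential c V) (hN : 1 ≤ N) (p : P) :
    ∃ w : EuclideanSpace ℝ (Fin N) → P, MemLp w 2 (volume.restrict (unitCube N)) ∧
      ∫ y in unitCube N, w y = p ∧
      ∫ y in unitCube N, legendre (legendre (V y)) (w y) ≤ legendre (meanConjugate V) p := by
  have hc := hV.pos
  set L := legendre (meanConjugate V) p
  set μ := volume.restrict (unitCube N)
  have hηpos : ∀ n : ℕ, (0 : ℝ) < 1 / (n + 1) := fun n => by positivity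
  choose w hwm hwb hwp hwe using fun n : ℕ => hV.exists_near_legendre_meanConjugate hN p (hηpos n)
  have hwL : ∀ n, MemLp (w n) 2 μ := fun n => memLp_of_measurable_of_bounded (hwm n) (hwb n)
  set u : ℕ → Lp P 2 μ := fun n => (hwL n).toLp (w n)
  have hu : ∀ n, ∀ᵐ y ∂μ, u n y = w n y := fun n => (hwL n).coeFn_toLp
  have hue : ∀ n, ∫ y, V y (u n y) ∂μ = ∫ y, V y (w n y) ∂μ := fun n =>
    integral_congr_ae ((hu n).mono fun y hy => by simp only [hy])
  have hz : Tendsto (fun n : ℕ => (1 : ℝ) / (n + 1)) atTop (𝓝 0) :=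
    tendsto_one_div_add_atTop_nhds_zero_nat
  have hbd : ∀ n, ‖u n‖ ≤ Real.sqrt (c * (L + 1 + c)) := by
    intro n
    refine Real.le_sqrt_of_sq_le ((hV.norm_sq_le measurable_id (u n)).trans ?_)
    refine mul_le_mul_of_nonneg_left ?_ hc.le
    have h1 : (1 : ℝ) / (n + 1) ≤ 1 := by
      rw [div_le_one (by positivity)]
      linarith [(Nat.cast_nonneg n : (0 : ℝ) ≤ n)]
    have h2 := hwe n
    simp only [id, hue n, μ, probReal_univ, mul_one]
    linarith
  have := separableSpace_L2 (μ := μ) (P := P)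
  obtain ⟨σ, hσ, v, hv⟩ := exists_subseq_tendsto_inner hbd
  have hweak := tendsto_integral_inner_of_weak hv
  have hzσ := hz.comp hσ.tendsto_atTop
  have hint : ∀ z : Lp P 2 μ, Integrable z μ := fun z => (Lp.memLp z).integrable one_le_two
  refine ⟨v, Lp.memLp v, ?_, ?_⟩
  · refine ext_inner_left ℝ fun ξ => ?_
    have h1 := hweak (fun _ => ξ) measurable_const ⟨‖ξ‖, fun _ => le_rfl⟩
    have h2 : ∀ z : Lp P 2 μ, ∫ y, inner ℝ ξ (z y) ∂μ = inner ℝ ξ (∫ y, z y ∂μ) :=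
      fun z => integral_inner (hint z) ξ
    simp only [h2] at h1
    refine tendsto_nhds_unique h1 (Tendsto.inner tendsto_const_nhds ?_)
    refine tendsto_iff_norm_sub_tendsto_zero.2
      (squeeze_zero (fun n => norm_nonneg _) (fun n => ?_) hzσ)
    rw [integral_congr_ae (hu (σ n))]
    exact (hwp (σ n)).le
  · refine le_of_forall_pos_sub_le fun η hη => ?_
    have hev := eventually_integral_le_of_affine_minorants (fun n => hint (u (σ n))) (hint v)
      (Lp.stronglyMeasurable v).measurable hweak
      (d := TopologicalSpace.denseSeq P)
      (K := fun _ l y => legendre (V y) (TopologicalSpace.denseSeq P l))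
      (fun _ l => hV.integrableOn_legendre _)
      (K' := fun l y => legendre (V y) (TopologicalSpace.denseSeq P l))
      (fun l => hV.integrableOn_legendre _) (fun l => hV.measurable_legendre _)
      (fun l A _ => tendsto_const_nhds)
      (V := fun n y => V y (u (σ n) y))
      (fun n => hV.integrable_comp measurable_id (Lp.memLp _))
      (fun n => ae_of_all _ fun y l => by
        have := (hV.growth y).le_legendre hc (TopologicalSpace.denseSeq P l) (u (σ n) y)
        linarith)
      (f := fun y => legendre (legendre (V y)) (v y))
      (hV.biconjugate.integrable_comp measurable_id (Lp.memLp _))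
      (fun y => by
        have := ((hV.growth y).legendre hc).isLUB_legendre_dense hV.four_mul_pos
          (continuous_of_convexOn ((hV.growth y).convexOn_legendre hc))
          (TopologicalSpace.denseRange_denseSeq P) (v y)
        simpa only [real_inner_comm (v y)] using this) hη
    have hlim : Tendsto (fun n => L + (1 : ℝ) / (σ n + 1)) atTop (𝓝 L) := by
      simpa using hzσ.const_add L
    refine ge_of_tendsto hlim (hev.mono fun n hn => hn.trans ?_)
    rw [hue]
    exact (hwe _).le

end IsPeriodicPotential

theorem IsPeriodicPotential.isLeast_cellValues {N M : ℕ} {c : ℝ}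
    {V : EuclideanSpace ℝ (Fin N) → EuclideanSpace ℝ (Fin M) → ℝ} (hV : IsPeriodicPotential c V)
    (hN : 1 ≤ N) (p : EuclideanSpace ℝ (Fin M)) :
    IsLeast (cellValues V p) (ENNReal.ofReal (legendre (meanConjugate V) p)) := by
  have henv : ∀ y q, convexEnvelope (V y) q = legendre (legendre (V y)) q := fun y q =>
    (hV.growth y).convexEnvelope_eq hV.pos q
  have hlower : ∀ t ∈ cellValues V p, ENNReal.ofReal (legendre (meanConjugate V) p) ≤ t := by
    rintro _ ⟨φ, hφ, hφ0, rfl⟩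
    have hw : MemLp (fun y => p + φ y) 2 (volume.restrict (unitCube N)) :=
      (memLp_const p).add hφ
    have hF : IntegrableOn (fun y => legendre (legendre (V y)) (p + φ y)) (unitCube N) :=
      hV.biconjugate.integrable_comp measurable_id hw
    simp only [henv]
    rw [← ofReal_integral_eq_lintegral_ofReal hF
      (ae_of_all _ fun y => hV.biconjugate.nonneg _ _)]
    refine ENNReal.ofReal_le_ofReal ?_
    have hmean : ∫ y in unitCube N, p + φ y = p := by
      rw [integral_add (integrable_const p) (hφ.integrable one_le_two), hφ0, integral_const,
        probReal_univ, one_smul, add_zero]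
    have h := hV.legendre_meanConjugate_le (hw.integrable one_le_two) hF fun y ξ => by
      have := ((hV.growth y).legendre hV.pos).le_legendre hV.four_mul_pos (p + φ y) ξ
      rwa [real_inner_comm] at this
    rwa [hmean] at h
  refine ⟨?_, hlower⟩
  obtain ⟨w, hw, hwp, hwe⟩ := hV.exists_memLp_biconjugate_le hN p
  have hmem : ∫⁻ y in unitCube N, ENNReal.ofReal (legendre (legendre (V y)) (w y)) ∈
      cellValues V p := by
    refine ⟨fun y => w y - p, hw.sub (memLp_const p), ?_, ?_⟩
    · rw [integral_sub (hw.integrable one_le_two) (integrable_const p), hwp, integral_const,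
        probReal_univ, one_smul, sub_self]
    · simp only [henv, add_sub_cancel]
  have heq : ENNReal.ofReal (legendre (meanConjugate V) p) =
      ∫⁻ y in unitCube N, ENNReal.ofReal (legendre (legendre (V y)) (w y)) := by
    refine le_antisymm (hlower _ hmem) ?_
    rw [← ofReal_integral_eq_lintegral_ofReal
      (f := fun y => legendre (legendre (V y)) (w y))
      (hV.biconjugate.integrable_comp measurable_id hw)
      (ae_of_all _ fun y => hV.biconjugate.nonneg _ _)]
    exact ENNReal.ofReal_le_ofReal hwe
  rw [heq]
  exact hmem

/-! ### The lower bound -/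

theorem tendsto_setIntegral_oscillating {N : ℕ} {f : EuclideanSpace ℝ (Fin N) → ℝ}
    (hf : Measurable f) (hper : LatticePeriodic f) {C : ℝ} (hC : ∀ x, |f x| ≤ C)
    {A : Set (EuclideanSpace ℝ (Fin N))} (hA : MeasurableSet A) (hAf : volume A ≠ ⊤)
    {δ : ℕ → ℝ} (hδ : ∀ n, 0 < δ n) (hδ0 : Tendsto δ atTop (𝓝 0)) :
    Tendsto (fun n => ∫ x in A, f ((δ n)⁻¹ • x)) atTop
      (𝓝 (volume.real A * ∫ y in unitCube N, f y)) := by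
  have key := tendsto_integral_oscillating hf hper hC (g := A.indicator fun _ => (1 : ℝ))
    ((integrable_indicator_iff hA).2 (integrableOn_const hAf)) hδ hδ0
  rw [integral_indicator_const _ hA, smul_eq_mul, smul_eq_mul, mul_one, mul_comm] at key
  refine key.congr fun n => ?_
  rw [← integral_indicator hA]
  congr 1
  ext x
  by_cases hx : x ∈ A <;> simp [hx]

namespace IsPeriodicPotential

variable {N : ℕ} {P : Type*} [NormedAddCommGroup P] [InnerProductSpace ℝ P]
  [FiniteDimensional ℝ P] [MeasurableSpace P] [BorelSpace P]
  {c : ℝ} {V : EuclideanSpace ℝ (Fin N) → P → ℝ}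

/-- The lower bound along weakly convergent sequences. The potential is estimated from below by
`⟪ξ, ·⟫ - legendre (V _) ξ`, where the second term oscillates around `meanConjugate V ξ`. -/
theorem eventually_integral_legendre_meanConjugate_le (hV : IsPeriodicPotential c V)
    {Ω : Set (EuclideanSpace ℝ (Fin N))} (hΩ : MeasurableSet Ω) (hΩf : volume Ω ≠ ⊤)
    {δ : ℕ → ℝ} (hδ : ∀ n, 0 < δ n) (hδ0 : Tendsto δ atTop (𝓝 0))
    {u : ℕ → Lp P 2 (volume.restrict Ω)} {v : Lp P 2 (volume.restrict Ω)}
    (h : ∀ e, Tendsto (fun n => inner ℝ (u n) e) atTop (𝓝 (inner ℝ v e)))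
    {η : ℝ} (hη : 0 < η) :
    ∀ᶠ n in atTop, (∫ x in Ω, legendre (meanConjugate V) (v x)) - η ≤
      ∫ x in Ω, V ((δ n)⁻¹ • x) (u n x) := by
  have : IsFiniteMeasure (volume.restrict Ω) := isFiniteMeasure_restrict.2 hΩf
  have hint : ∀ z : Lp P 2 (volume.restrict Ω), Integrable z (volume.restrict Ω) :=
    fun z => (Lp.memLp z).integrable one_le_two
  refine eventually_integral_le_of_affine_minorants (fun n => hint (u n)) (hint v)
    (Lp.stronglyMeasurable v).measurable (tendsto_integral_inner_of_weak h)
    (d := TopologicalSpace.denseSeq P)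
    (K := fun n l x => legendre (V ((δ n)⁻¹ • x)) (TopologicalSpace.denseSeq P l))
    (fun n l => hV.integrable_legendre (measurable_const_smul (δ n)⁻¹) _)
    (K' := fun l _ => meanConjugate V (TopologicalSpace.denseSeq P l))
    (fun l => integrable_const _) (fun l => measurable_const)
    (fun l A hA => ?_)
    (fun n => hV.integrable_comp (measurable_const_smul (δ n)⁻¹) (Lp.memLp _))
    (fun n => ae_of_all _ fun x l => ?_)
    (hV.integrable_legendre_meanConjugate (Lp.memLp v)) (fun x => ?_) hη
  · rw [Measure.restrict_restrict hA, setIntegral_const]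
    exact tendsto_setIntegral_oscillating (hV.measurable_legendre _)
      (hV.latticePeriodic_legendre _) (hV.abs_legendre_le _) (hA.inter hΩ)
      (measure_ne_top_of_subset inter_subset_right hΩf) hδ hδ0
  · have := (hV.growth ((δ n)⁻¹ • x)).le_legendre hV.pos (TopologicalSpace.denseSeq P l) (u n x)
    linarith
  · have := hV.growth_meanConjugate.isLUB_legendre_dense hV.four_mul_pos
      hV.continuous_meanConjugate (TopologicalSpace.denseRange_denseSeq P) (v x)
    simpa only [real_inner_comm (v x)] using this

/-! ### Smooth periodic competitors -/

/-- Periodic extension followed by mollification makes a competitor smooth. The mollified functions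
are uniformly bounded and converge almost everywhere, hence so do their energies. -/
theorem exists_smooth_near (hV : IsPeriodicPotential c V) {w : EuclideanSpace ℝ (Fin N) → P}
    (hw : Measurable w) (hb : ∃ C, ∀ x, ‖w x‖ ≤ C) {η : ℝ} (hη : 0 < η) :
    ∃ W : EuclideanSpace ℝ (Fin N) → P, ContDiff ℝ ∞ W ∧ LatticePeriodic W ∧
      ‖(∫ y in unitCube N, W y) - ∫ y in unitCube N, w y‖ < η ∧
      ∫ y in unitCube N, V y (W y) < (∫ y in unitCube N, V y (w y)) + η := by
  obtain ⟨C, hC⟩ := hb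
  set g : EuclideanSpace ℝ (Fin N) → P := fun x => w (cellPart x)
  have hgm : Measurable g := hw.comp measurable_cellPart
  have hgC : ∀ x, ‖g x‖ ≤ C := fun x => hC _
  have hgp : LatticePeriodic g := latticePeriodic_cellPart.comp w
  have hgl : LocallyIntegrable g := by
    refine (locallyIntegrable_const C).mono hgm.aestronglyMeasurable (ae_of_all _ fun x => ?_)
    rw [Real.norm_eq_abs]
    exact (hgC x).trans (le_abs_self C)
  set φ : ℕ → ContDiffBump (0 : EuclideanSpace ℝ (Fin N)) := fun n =>
    ⟨1 / (n + 1), 2 * (1 / (n + 1)), by positivity, by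
      have : (0 : ℝ) < 1 / (n + 1) := by positivity
      linarith⟩
  set W : ℕ → EuclideanSpace ℝ (Fin N) → P := fun n =>
    convolution ((φ n).normed volume) g (ContinuousLinearMap.lsmul ℝ ℝ) volume
  have hWs : ∀ n, ContDiff ℝ ∞ (W n) := fun n =>
    (φ n).hasCompactSupport_normed.contDiff_convolution_left (n := ⊤) _ (φ n).contDiff_normed hgl
  have hWp : ∀ n, LatticePeriodic (W n) := by
    intro n x z
    simp only [W, convolution]
    refine integral_congr_ae (ae_of_all _ fun t => ?_)
    simp only
    rw [add_sub_right_comm, hgp]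
  have hWb : ∀ n x, ‖W n x‖ ≤ 3 * C := by
    intro n x
    have h1 := (φ n).dist_normed_convolution_le (μ := volume) (x₀ := x) (ε := 2 * C)
      hgm.aestronglyMeasurable
      fun y _ => by
        rw [dist_eq_norm]
        linarith [norm_sub_le (g y) (g x), hgC x, hgC y]
    rw [dist_eq_norm] at h1
    have h2 := norm_sub_norm_le (W n x) (g x)
    linarith [hgC x]
  have hφ0 : Tendsto (fun n => (φ n).rOut) atTop (𝓝 0) := by
    have := (tendsto_one_div_add_atTop_nhds_zero_nat (𝕜 := ℝ)).const_mul 2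
    rwa [mul_zero] at this
  have hlim : ∀ᵐ x, Tendsto (fun n => W n x) atTop (𝓝 (g x)) :=
    ContDiffBump.ae_convolution_tendsto_right_of_locallyIntegrable (K := 2) hφ0
      (Eventually.of_forall fun n => le_rfl) hgl
  have hlimQ : ∀ᵐ x ∂(volume.restrict (unitCube N)), Tendsto (fun n => W n x) atTop (𝓝 (w x)) := by
    filter_upwards [ae_restrict_of_ae hlim, ae_restrict_mem measurableSet_unitCube] with x hx hxQ
    simpa only [g, cellPart_eq_self hxQ] using hx
  have l1 : Tendsto (fun n => ∫ y in unitCube N, W n y) atTop (𝓝 (∫ y in unitCube N, w y)) :=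
    tendsto_integral_of_dominated_convergence (fun _ => 3 * C)
      (fun n => (hWs n).continuous.aestronglyMeasurable) (integrable_const _)
      (fun n => ae_of_all _ (hWb n)) hlimQ
  have l2 : Tendsto (fun n => ∫ y in unitCube N, V y (W n y)) atTop
      (𝓝 (∫ y in unitCube N, V y (w y))) := by
    refine tendsto_integral_of_dominated_convergence (fun _ => c * (1 + (3 * C) ^ 2))
      (fun n => (hV.integrableOn_comp (hWs n).continuous.measurable ⟨_, hWb n⟩).1)
      (integrable_const _) (fun n => ae_of_all _ fun y => ?_)
      (hlimQ.mono fun y hy => ((hV.continuous y).tendsto _).comp hy)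
    refine ((hV.growth y).abs_le hV.pos _).trans ?_
    have := hV.pos
    gcongr
    exact hWb n y
  obtain ⟨n, h1, h2⟩ := ((Metric.tendsto_nhds.1 l1 η hη).and
    (l2.eventually (gt_mem_nhds (lt_add_of_pos_right _ hη)))).exists
  exact ⟨W n, hWs n, hWp n, by rwa [← dist_eq_norm], h2⟩

theorem exists_smooth_near_legendre_meanConjugate (hV : IsPeriodicPotential c V) (hN : 1 ≤ N)
    (p : P) {η : ℝ} (hη : 0 < η) :
    ∃ w : EuclideanSpace ℝ (Fin N) → P, ContDiff ℝ ∞ w ∧ LatticePeriodic w ∧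
      ‖(∫ y in unitCube N, w y) - p‖ ≤ η ∧
      ∫ y in unitCube N, V y (w y) ≤ legendre (meanConjugate V) p + η := by
  obtain ⟨w₀, hm, hb, h1, h2⟩ := hV.exists_near_legendre_meanConjugate hN p (half_pos hη)
  obtain ⟨w, hs, hp, h3, h4⟩ := hV.exists_smooth_near hm hb (half_pos hη)
  refine ⟨w, hs, hp, ?_, by linarith⟩
  linarith [norm_sub_le_norm_sub_add_norm_sub (∫ y in unitCube N, w y)
    (∫ y in unitCube N, w₀ y) p]

end IsPeriodicPotential

/-! ### Weak gradients -/

section Gradient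

variable {N M : ℕ} {Ω : Set (EuclideanSpace ℝ (Fin N))}

theorem IsWeakGradient.congr {u v : EuclideanSpace ℝ (Fin N) → EuclideanSpace ℝ (Fin M)}
    {g : Fin N → EuclideanSpace ℝ (Fin N) → EuclideanSpace ℝ (Fin M)}
    (h : IsWeakGradient Ω u g) (huv : u =ᵐ[volume.restrict Ω] v) : IsWeakGradient Ω v g := by
  refine ⟨h.1, fun j φ h1 h2 h3 => ?_⟩
  rw [← h.2 j φ h1 h2 h3]
  refine integral_congr_ae ?_
  filter_upwards [huv] with x hx
  rw [hx]

theorem isWeakGradient_fderiv {U : EuclideanSpace ℝ (Fin N) → EuclideanSpace ℝ (Fin M)}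
    (hU : ContDiff ℝ ∞ U)
    (hL : ∀ j, MemLp (fun x => fderiv ℝ U x (EuclideanSpace.single j 1)) 2 (volume.restrict Ω)) :
    IsWeakGradient Ω U fun j x => fderiv ℝ U x (EuclideanSpace.single j 1) := by
  refine ⟨hL, fun j φ hφ hc hs => ?_⟩
  have hφd : Continuous fun x => fderiv ℝ φ x (EuclideanSpace.single j 1) :=
    (hφ.continuous_fderiv (by simp)).clm_apply continuous_const
  have hUd : Continuous fun x => fderiv ℝ U x (EuclideanSpace.single j 1) :=
    (hU.continuous_fderiv (by simp)).clm_apply continuous_const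
  have hcd : HasCompactSupport fun x => fderiv ℝ φ x (EuclideanSpace.single j 1) :=
    hc.fderiv_apply (𝕜 := ℝ) _
  have key := integral_smul_fderiv_eq_neg_fderiv_smul_of_integrable (μ := volume)
    (f := φ) (g := U) (v := EuclideanSpace.single j 1)
    ((hφd.smul hU.continuous).integrable_of_hasCompactSupport hcd.smul_right)
    ((hφ.continuous.smul hUd).integrable_of_hasCompactSupport hc.smul_right)
    ((hφ.continuous.smul hU.continuous).integrable_of_hasCompactSupport hc.smul_right)
    (fun x _ => hφ.differentiable (by simp) x) (fun x _ => hU.differentiable (by simp) x)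
  have hzero : ∀ x, x ∉ Ω → φ x = 0 := fun x hx =>
    image_eq_zero_of_notMem_tsupport fun h => hx (hs h)
  have hzero' : ∀ x, x ∉ Ω → fderiv ℝ φ x = 0 := fun x hx =>
    image_eq_zero_of_notMem_tsupport fun h => hx (hs (tsupport_fderiv_subset ℝ h))
  rw [setIntegral_eq_integral_of_forall_compl_eq_zero fun x hx => by simp [hzero' x hx],
    setIntegral_eq_integral_of_forall_compl_eq_zero fun x hx => by simp [hzero x hx], key, neg_neg]

/-- Weak gradients are unique. -/
theorem IsWeakGradient.ae_eq (hΩ : IsOpen Ω)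
    {u : EuclideanSpace ℝ (Fin N) → EuclideanSpace ℝ (Fin M)}
    {g g' : Fin N → EuclideanSpace ℝ (Fin N) → EuclideanSpace ℝ (Fin M)}
    (h : IsWeakGradient Ω u g) (h' : IsWeakGradient Ω u g') (j : Fin N) :
    g j =ᵐ[volume.restrict Ω] g' j := by
  have hloc : LocallyIntegrableOn (fun x => g j x - g' j x) Ω := by
    refine (locallyIntegrableOn_iff hΩ.isLocallyClosed).2 fun K hKΩ hK => ?_
    have hfin : IsFiniteMeasure (volume.restrict K) := isFiniteMeasure_restrict.2 hK.measure_ne_top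
    have hm : MemLp (fun x => g j x - g' j x) 2 (volume.restrict K) :=
      ((h.1 j).sub (h'.1 j)).mono_measure (Measure.restrict_mono hKΩ le_rfl)
    exact hm.integrable one_le_two
  have key := hΩ.ae_eq_zero_of_integral_contDiff_smul_eq_zero hloc fun φ hφ hc hs => by
    have hb : ∃ C, ∀ x, ‖φ x‖ ≤ C := hc.exists_bound_of_continuous hφ.continuous
    obtain ⟨C, hC⟩ := hb
    have hφL : MemLp φ 2 (volume.restrict Ω) :=
      (hφ.continuous.memLp_of_hasCompactSupport hc).restrict Ω
    have hi : ∀ g : EuclideanSpace ℝ (Fin N) → EuclideanSpace ℝ (Fin M),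
        MemLp g 2 (volume.restrict Ω) → IntegrableOn (fun x => φ x • g x) Ω := fun g hg =>
      memLp_one_iff_integrable.1 (hg.smul hφL)
    have hzero : ∀ x, x ∉ Ω → φ x • (g j x - g' j x) = 0 := fun x hx => by
      rw [image_eq_zero_of_notMem_tsupport fun h => hx (hs h), zero_smul]
    rw [← setIntegral_eq_integral_of_forall_compl_eq_zero hzero]
    simp only [smul_sub]
    rw [integral_sub (hi _ (h.1 j)) (hi _ (h'.1 j))]
    have e1 := h.2 j φ hφ hc hs
    have e2 := h'.2 j φ hφ hc hs
    rw [e1] at e2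
    rw [sub_eq_zero]
    exact neg_injective e2
  refine (ae_restrict_iff' hΩ.measurableSet).2 ?_
  filter_upwards [key] with x hx hxΩ
  exact sub_eq_zero.1 (hx hxΩ)

end Gradient

/-! ### Recovery sequences -/

section Energy

variable {N M : ℕ} {Ω : Set (EuclideanSpace ℝ (Fin N))} {c : ℝ}
  {V : EuclideanSpace ℝ (Fin N) → EuclideanSpace ℝ (Fin M) → ℝ}

theorem phaseEnergy_toLp_le (hV : IsPeriodicPotential c V) (hΩ : IsOpen Ω) (hΩf : volume Ω ≠ ⊤)
    {U : EuclideanSpace ℝ (Fin N) → EuclideanSpace ℝ (Fin M)} (hU : ContDiff ℝ ∞ U)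
    (hUL : MemLp U 2 (volume.restrict Ω)) {G : ℝ} (hG : ∀ x ∈ Ω, ‖fderiv ℝ U x‖ ≤ G) (ε δ : ℝ) :
    phaseEnergy Ω V ε δ (hUL.toLp U) ≤
      ENNReal.ofReal ((∫ x in Ω, V (δ⁻¹ • x) (U x)) + ε ^ 2 * (N * G ^ 2) * volume.real Ω) := by
  have : IsFiniteMeasure (volume.restrict Ω) := isFiniteMeasure_restrict.2 hΩf
  have hGj : ∀ j, ∀ x ∈ Ω, ‖fderiv ℝ U x (EuclideanSpace.single j 1)‖ ≤ G := fun j x hx => by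
    refine ((fderiv ℝ U x).le_opNorm _).trans ?_
    simpa using hG x hx
  have hgrad : IsWeakGradient Ω (hUL.toLp U)
      fun j x => fderiv ℝ U x (EuclideanSpace.single j 1) := by
    refine (isWeakGradient_fderiv hU fun j => ?_).congr hUL.coeFn_toLp.symm
    exact MemLp.of_bound ((hU.continuous_fderiv (by simp)).clm_apply
      continuous_const).aestronglyMeasurable G (ae_restrict_of_forall_mem hΩ.measurableSet (hGj j))
  have hmem : hUL.toLp U ∈ sobolevW12 Ω M := ⟨_, hgrad⟩
  have hw : ∀ j, weakGradient hmem j =ᵐ[volume.restrict Ω]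
      fun x => fderiv ℝ U x (EuclideanSpace.single j 1) := fun j =>
    IsWeakGradient.ae_eq hΩ hmem.choose_spec hgrad j
  have hi := hV.integrable_comp (measurable_const_smul δ⁻¹) hUL
  have hcoef : 0 ≤ ε ^ 2 * (N * G ^ 2) := by positivity
  rw [phaseEnergy, dif_pos hmem]
  have h1 : ∫⁻ x in Ω, ENNReal.ofReal
      (V (δ⁻¹ • x) (hUL.toLp U x) + ε ^ 2 * ∑ j, ‖weakGradient hmem j x‖ ^ 2) ≤
      ∫⁻ x in Ω, ENNReal.ofReal (V (δ⁻¹ • x) (U x) + ε ^ 2 * (N * G ^ 2)) := by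
    refine lintegral_mono_ae ?_
    filter_upwards [hUL.coeFn_toLp, ae_all_iff.2 hw, ae_restrict_mem hΩ.measurableSet]
      with x h1 h2 hx
    rw [h1]
    have h3 : ∑ j, ‖weakGradient hmem j x‖ ^ 2 ≤ N * G ^ 2 := by
      calc ∑ j, ‖weakGradient hmem j x‖ ^ 2 ≤ ∑ _j : Fin N, G ^ 2 := by
            refine Finset.sum_le_sum fun j _ => ?_
            rw [h2 j]
            exact pow_le_pow_left₀ (norm_nonneg _) (hGj j x hx) 2
        _ = N * G ^ 2 := by simp
    gcongr
  refine h1.trans ?_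
  rw [← ofReal_integral_eq_lintegral_ofReal
    (f := fun x => V (δ⁻¹ • x) (U x) + ε ^ 2 * (N * G ^ 2)) (hi.add (integrable_const _))
    (ae_of_all _ fun x => add_nonneg (hV.nonneg _ _) hcoef), integral_add hi (integrable_const _),
    integral_const, smul_eq_mul, measureReal_restrict_apply_univ, mul_comm (volume.real Ω)]

end Energy

/-- Smooth cutoff functions for compact sets that nearly exhaust the level sets of a simple
function. -/
theorem exists_smooth_cutoffs {N : ℕ} {P : Type*} {Ω : Set (EuclideanSpace ℝ (Fin N))}
    (hΩ : MeasurableSet Ω) (hΩf : volume Ω ≠ ⊤) (s : SimpleFunc (EuclideanSpace ℝ (Fin N)) P)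
    {ρ : ℝ} (hρ : 0 < ρ) :
    ∃ (K : P → Set (EuclideanSpace ℝ (Fin N))) (χ : P → EuclideanSpace ℝ (Fin N) → ℝ),
      (∀ p, IsClosed (K p)) ∧ (∀ p, K p ⊆ s ⁻¹' {p} ∩ Ω) ∧
      (∀ p, ContDiff ℝ ∞ (χ p)) ∧ (∀ p x, |χ p x| ≤ 1) ∧
      (∀ p, ∀ x ∈ K p, χ p x = 1) ∧
      (∀ p, ∀ q ∈ s.range, p ≠ q → ∀ x ∈ K q, χ p x = 0) ∧
      volume.real (Ω \ ⋃ p ∈ s.range, K p) ≤ ρ := by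
  set r : ℝ := ρ / (s.range.card + 1)
  have hr : 0 < r := by positivity
  have hset : ∀ p, MeasurableSet (s ⁻¹' {p} ∩ Ω) := fun p => (s.measurableSet_fiber p).inter hΩ
  choose K hKsub hKc hKm using fun p : P => (hset p).exists_isCompact_sdiff_lt
    (measure_ne_top_of_subset inter_subset_right hΩf) (ENNReal.ofReal_pos.2 hr).ne'
  have hdisj : ∀ p q, p ≠ q → Disjoint (K p) (K q) := fun p q hpq =>
    disjoint_left.2 fun x hp hq => hpq (((hKsub p hp).1 : s x = p).symm.trans (hKsub q hq).1)
  have hχ : ∀ p, ∃ χ : EuclideanSpace ℝ (Fin N) → ℝ, ContDiff ℝ ∞ χ ∧ (∀ x, |χ x| ≤ 1) ∧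
      (∀ x ∈ K p, χ x = 1) ∧ ∀ q ∈ s.range, p ≠ q → ∀ x ∈ K q, χ x = 0 := by
    classical
    intro p
    have hcl : IsClosed (⋃ q ∈ s.range.erase p, K q) :=
      isClosed_biUnion_finset fun q _ => (hKc q).isClosed
    have hd : Disjoint (⋃ q ∈ s.range.erase p, K q) (K p) :=
      disjoint_iUnion₂_left.2 fun q hq => hdisj q p (Finset.ne_of_mem_erase hq)
    obtain ⟨f, hf0, hf1, hf⟩ := exists_contMDiffMap_zero_one_of_isClosed (n := ⊤)
      (modelWithCornersSelf ℝ (EuclideanSpace ℝ (Fin N))) hcl (hKc p).isClosed hd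
    refine ⟨f, contMDiff_iff_contDiff.1 f.contMDiff, fun x => ?_, fun x hx => hf1 hx,
      fun q hq hpq x hx => hf0 (mem_iUnion₂.2 ⟨q, Finset.mem_erase.2 ⟨hpq.symm, hq⟩, hx⟩)⟩
    rw [abs_of_nonneg (hf x).1]
    exact (hf x).2
  choose χ h1 h2 h3 h4 using hχ
  refine ⟨K, χ, fun p => (hKc p).isClosed, hKsub, h1, h2, h3, h4, ?_⟩
  refine ENNReal.toReal_le_of_le_ofReal hρ.le ?_
  have hsub : Ω \ ⋃ p ∈ s.range, K p ⊆ ⋃ p ∈ s.range, ((s ⁻¹' {p} ∩ Ω) \ K p) := fun x hx =>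
    mem_iUnion₂.2 ⟨s x, s.mem_range_self x, ⟨rfl, hx.1⟩, fun h =>
      hx.2 (mem_iUnion₂.2 ⟨s x, s.mem_range_self x, h⟩)⟩
  calc volume (Ω \ ⋃ p ∈ s.range, K p)
      ≤ ∑ p ∈ s.range, volume ((s ⁻¹' {p} ∩ Ω) \ K p) :=
        (measure_mono hsub).trans (measure_biUnion_finset_le _ _)
    _ ≤ ∑ _p ∈ s.range, ENNReal.ofReal r := Finset.sum_le_sum fun p _ => (hKm p).le
    _ = ENNReal.ofReal (s.range.card * r) := by
        rw [Finset.sum_const, nsmul_eq_mul, ENNReal.ofReal_mul (by positivity),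
          ENNReal.ofReal_natCast]
    _ ≤ ENNReal.ofReal ρ := by
        refine ENNReal.ofReal_le_ofReal ?_
        simp only [r]
        rw [mul_div_assoc', div_le_iff₀ (by positivity)]
        nlinarith

section Template

variable {N M : ℕ}

/-- The function that oscillates like `w p` at scale `δ` in the region selected by the cutoff
function `χ p`. -/
noncomputable def oscillatingPatchwork (T : Finset (EuclideanSpace ℝ (Fin M)))
    (χ : EuclideanSpace ℝ (Fin M) → EuclideanSpace ℝ (Fin N) → ℝ)
    (w : EuclideanSpace ℝ (Fin M) → EuclideanSpace ℝ (Fin N) → EuclideanSpace ℝ (Fin M)) (δ : ℝ)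
    (x : EuclideanSpace ℝ (Fin N)) : EuclideanSpace ℝ (Fin M) :=
  ∑ p ∈ T, χ p x • w p (δ⁻¹ • x)

theorem LatticePeriodic.fderiv {w : EuclideanSpace ℝ (Fin N) → EuclideanSpace ℝ (Fin M)}
    (hw : LatticePeriodic w) : LatticePeriodic (_root_.fderiv ℝ w) := by
  intro x z
  rw [← fderiv_comp_add_right]
  congr 1
  exact funext fun y => hw y z

variable {T : Finset (EuclideanSpace ℝ (Fin M))}
  {χ : EuclideanSpace ℝ (Fin M) → EuclideanSpace ℝ (Fin N) → ℝ}
  {w : EuclideanSpace ℝ (Fin M) → EuclideanSpace ℝ (Fin N) → EuclideanSpace ℝ (Fin M)}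

theorem contDiff_oscillatingPatchwork (hχ : ∀ p, ContDiff ℝ ∞ (χ p)) (hw : ∀ p, ContDiff ℝ ∞ (w p))
    (δ : ℝ) : ContDiff ℝ ∞ (oscillatingPatchwork T χ w δ) :=
  ContDiff.sum fun p _ => (hχ p).smul ((hw p).comp (contDiff_const_smul _))

theorem norm_sum_smul_le {χ : EuclideanSpace ℝ (Fin M) → ℝ} (hχ : ∀ p, |χ p| ≤ 1)
    {m : EuclideanSpace ℝ (Fin M) → EuclideanSpace ℝ (Fin M)} {C : EuclideanSpace ℝ (Fin M) → ℝ}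
    (hm : ∀ p, ‖m p‖ ≤ C p) : ‖∑ p ∈ T, χ p • m p‖ ≤ ∑ p ∈ T, C p := by
  refine norm_sum_le_of_le _ fun p _ => ?_
  rw [norm_smul, Real.norm_eq_abs]
  nlinarith [hχ p, hm p, abs_nonneg (χ p), norm_nonneg (m p)]

theorem exists_norm_fderiv_oscillatingPatchwork_le {Ω : Set (EuclideanSpace ℝ (Fin N))}
    (hΩb : Bornology.IsBounded Ω)
    (hχ : ∀ p, ContDiff ℝ ∞ (χ p)) (hχ1 : ∀ p x, |χ p x| ≤ 1)
    (hw : ∀ p, ContDiff ℝ ∞ (w p)) (hper : ∀ p, LatticePeriodic (w p)) :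
    ∃ C, ∀ δ ∈ Ioo (0 : ℝ) 1, ∀ x ∈ Ω, ‖fderiv ℝ (oscillatingPatchwork T χ w δ) x‖ ≤ C / δ := by
  have hone : ∀ p, ∃ C, ∀ δ ∈ Ioo (0 : ℝ) 1, ∀ x ∈ Ω,
      ‖fderiv ℝ (fun x => χ p x • w p (δ⁻¹ • x)) x‖ ≤ C / δ := by
    intro p
    obtain ⟨C₀, hC₀⟩ := (hper p).exists_norm_le (hw p).continuous
    obtain ⟨C₁, hC₁⟩ := (hper p).fderiv.exists_norm_le ((hw p).continuous_fderiv (by simp))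
    obtain ⟨C₂, hC₂⟩ := hΩb.isCompact_closure.exists_bound_of_continuousOn
      ((hχ p).continuous_fderiv (by simp)).continuousOn
    refine ⟨C₁ + C₂ * C₀, fun δ hδ x hx => ?_⟩
    have hδ1 : 1 ≤ δ⁻¹ := (one_le_inv₀ hδ.1).2 hδ.2.le
    have hdχ : DifferentiableAt ℝ (χ p) x := (hχ p).differentiable (by simp) x
    have hdw : DifferentiableAt ℝ (fun x => w p (δ⁻¹ • x)) x :=
      ((hw p).comp (contDiff_const_smul δ⁻¹)).differentiable (by simp) x
    have hsm : fderiv ℝ (fun x => w p (δ⁻¹ • x)) x = δ⁻¹ • fderiv ℝ (w p) (δ⁻¹ • x) := by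
      rw [fderiv_comp_smul]
    rw [fderiv_fun_smul hdχ hdw, hsm]
    have h2 := hC₂ x (subset_closure hx)
    have h0 := hC₀ (δ⁻¹ • x)
    have hC2 : 0 ≤ C₂ := (norm_nonneg _).trans h2
    have hC0 : 0 ≤ C₀ := (norm_nonneg _).trans h0
    calc _ ≤ ‖χ p x • δ⁻¹ • fderiv ℝ (w p) (δ⁻¹ • x)‖ +
          ‖(fderiv ℝ (χ p) x).smulRight (w p (δ⁻¹ • x))‖ := norm_add_le _ _
      _ ≤ 1 * (δ⁻¹ * C₁) + C₂ * C₀ := by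
          refine add_le_add ?_ ?_
          · rw [norm_smul, norm_smul, Real.norm_eq_abs, Real.norm_of_nonneg (by positivity)]
            gcongr
            · exact hχ1 p x
            · exact hC₁ _
          · rw [ContinuousLinearMap.norm_smulRight_apply]
            gcongr
      _ ≤ (C₁ + C₂ * C₀) / δ := by
          rw [div_eq_mul_inv]
          nlinarith [mul_nonneg hC2 hC0]
  choose C hC using hone
  refine ⟨∑ p ∈ T, C p, fun δ hδ x hx => ?_⟩
  have hsum : fderiv ℝ (oscillatingPatchwork T χ w δ) x =
      ∑ p ∈ T, fderiv ℝ (fun x => χ p x • w p (δ⁻¹ • x)) x := by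
    refine fderiv_fun_sum fun p _ => ?_
    exact ((hχ p).smul ((hw p).comp (contDiff_const_smul δ⁻¹))).differentiable (by simp) x
  rw [hsum, Finset.sum_div]
  exact norm_sum_le_of_le _ fun p _ => hC p δ hδ x hx

theorem tendsto_integral_inner_oscillating
    {w : EuclideanSpace ℝ (Fin N) → EuclideanSpace ℝ (Fin M)} (hw : Continuous w)
    (hper : LatticePeriodic w) {g : EuclideanSpace ℝ (Fin N) → EuclideanSpace ℝ (Fin M)}
    (hg : Integrable g) {δ : ℕ → ℝ} (hδ : ∀ n, 0 < δ n) (hδ0 : Tendsto δ atTop (𝓝 0)) :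
    Tendsto (fun n => ∫ x, inner ℝ (w ((δ n)⁻¹ • x)) (g x)) atTop
      (𝓝 (inner ℝ (∫ y in unitCube N, w y) (∫ x, g x))) := by
  obtain ⟨C, hC⟩ := hper.exists_norm_le hw
  have hwi : IntegrableOn w (unitCube N) :=
    Integrable.of_bound hw.aestronglyMeasurable C (ae_of_all _ hC)
  have hgi : ∀ i, Integrable fun x => g x i := fun i =>
    (EuclideanSpace.proj (𝕜 := ℝ) i).integrable_comp hg
  have hwc : ∀ i, Continuous fun x => w x i := fun i =>
    (EuclideanSpace.proj (𝕜 := ℝ) i).continuous.comp hw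
  have hwb : ∀ i x, |w x i| ≤ C := fun i x => (PiLp.norm_apply_le (w x) i).trans (hC x)
  have key : ∀ i, Tendsto (fun n => ∫ x, w ((δ n)⁻¹ • x) i • g x i) atTop
      (𝓝 ((∫ y in unitCube N, w y i) • ∫ x, g x i)) := fun i =>
    tendsto_integral_oscillating (hwc i).measurable (hper.comp fun p => p i) (hwb i) (hgi i) hδ hδ0
  have hlim := tendsto_finsetSum Finset.univ fun i _ => key i
  have e1 : ∀ n, ∫ x, inner ℝ (w ((δ n)⁻¹ • x)) (g x) =
      ∑ i, ∫ x, w ((δ n)⁻¹ • x) i • g x i := fun n => by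
    rw [← integral_finsetSum]
    · simp only [PiLp.inner_apply, RCLike.inner_apply, conj_trivial, smul_eq_mul, mul_comm]
    · exact fun i _ => (hgi i).bdd_smul C
        ((hwc i).comp (continuous_const_smul _)).aestronglyMeasurable (ae_of_all _ fun x => hwb i _)
  have e2 : inner ℝ (∫ y in unitCube N, w y) (∫ x, g x) =
      ∑ i, (∫ y in unitCube N, w y i) • ∫ x, g x i := by
    have h1 : ∀ i, (∫ y in unitCube N, w y) i = ∫ y in unitCube N, w y i := fun i =>
      ((EuclideanSpace.proj (𝕜 := ℝ) i).integral_comp_comm hwi).symm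
    have h2 : ∀ i, (∫ y, g y) i = ∫ y, g y i := fun i =>
      ((EuclideanSpace.proj (𝕜 := ℝ) i).integral_comp_comm hg).symm
    simp only [PiLp.inner_apply, RCLike.inner_apply, conj_trivial, smul_eq_mul, h1, h2, mul_comm]
  rw [e2]
  exact hlim.congr fun n => (e1 n).symm

/-- The patchwork converges weakly to the sum of the cutoff functions times the means. -/
theorem tendsto_integral_inner_oscillatingPatchwork {Ω : Set (EuclideanSpace ℝ (Fin N))}
    (hΩ : MeasurableSet Ω) (hΩf : volume Ω ≠ ⊤)
    (hχ : ∀ p, ContDiff ℝ ∞ (χ p)) (hχ1 : ∀ p x, |χ p x| ≤ 1)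
    (hw : ∀ p, ContDiff ℝ ∞ (w p)) (hper : ∀ p, LatticePeriodic (w p))
    {δ : ℕ → ℝ} (hδ : ∀ n, 0 < δ n) (hδ0 : Tendsto δ atTop (𝓝 0)) (e : L2 Ω M) :
    Tendsto (fun n => ∫ x in Ω, inner ℝ (oscillatingPatchwork T χ w (δ n) x) (e x)) atTop
      (𝓝 (∫ x in Ω, inner ℝ (∑ p ∈ T, χ p x • ∫ y in unitCube N, w p y) (e x))) := by
  have : IsFiniteMeasure (volume.restrict Ω) := isFiniteMeasure_restrict.2 hΩf
  have hχe : ∀ p, IntegrableOn (fun x => χ p x • e x) Ω := fun p =>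
    ((Lp.memLp e).integrable one_le_two).bdd_smul 1 (hχ p).continuous.aestronglyMeasurable
      (ae_of_all _ (hχ1 p))
  have key := tendsto_finsetSum T fun p _ => tendsto_integral_inner_oscillating
    (hw p).continuous (hper p) ((hχe p).integrable_indicator hΩ) hδ hδ0
  have e1 : ∀ n, ∫ x in Ω, inner ℝ (oscillatingPatchwork T χ w (δ n) x) (e x) =
      ∑ p ∈ T, ∫ x, inner ℝ (w p ((δ n)⁻¹ • x)) (Ω.indicator (fun x => χ p x • e x) x) := by
    intro n
    have h1 : ∀ p x, inner ℝ (w p ((δ n)⁻¹ • x)) (Ω.indicator (fun x => χ p x • e x) x) =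
        Ω.indicator (fun x => inner ℝ (χ p x • w p ((δ n)⁻¹ • x)) (e x)) x := fun p x => by
      by_cases hx : x ∈ Ω <;> simp [hx, real_inner_smul_left, real_inner_smul_right]
    simp only [h1, integral_indicator hΩ, oscillatingPatchwork, sum_inner]
    refine integral_finsetSum _ fun p _ => ?_
    obtain ⟨C, hC⟩ := (hper p).exists_norm_le (hw p).continuous
    refine ((hχe p).norm.const_mul C).mono'
      (AEStronglyMeasurable.inner (𝕜 := ℝ) ((hχ p).continuous.smul ((hw p).continuous.comp
        (continuous_const_smul (δ n)⁻¹))).aestronglyMeasurable (Lp.aestronglyMeasurable e))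
      (ae_of_all _ fun x => ?_)
    rw [real_inner_smul_left, ← real_inner_smul_right]
    exact (norm_inner_le_norm (𝕜 := ℝ) _ _).trans
      (mul_le_mul_of_nonneg_right (hC _) (norm_nonneg _))
  have e2 : ∫ x in Ω, inner ℝ (∑ p ∈ T, χ p x • ∫ y in unitCube N, w p y) (e x) =
      ∑ p ∈ T, inner ℝ (∫ y in unitCube N, w p y)
        (∫ x, Ω.indicator (fun x => χ p x • e x) x) := by
    simp only [integral_indicator hΩ, sum_inner, real_inner_smul_left]
    rw [integral_finsetSum]
    · refine Finset.sum_congr rfl fun p _ => ?_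
      rw [← integral_inner (hχe p)]
      simp only [real_inner_smul_right]
    · intro p _
      simpa only [real_inner_smul_right] using
        (hχe p).const_inner (𝕜 := ℝ) (∫ y in unitCube N, w p y)
  rw [e2]
  exact key.congr fun n => (e1 n).symm

end Template

namespace IsPeriodicPotential

variable {N M : ℕ} {c : ℝ} {V : EuclideanSpace ℝ (Fin N) → EuclideanSpace ℝ (Fin M) → ℝ}
  {Ω : Set (EuclideanSpace ℝ (Fin N))}

/-- Simple functions that are dominated pointwise by `2 ‖v‖` approximate both `v` and its limit
energy. -/
theorem exists_simpleFunc_near (hV : IsPeriodicPotential c V) (hΩf : volume Ω ≠ ⊤)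
    (v : L2 Ω M) {η : ℝ} (hη : 0 < η) :
    ∃ s : SimpleFunc (EuclideanSpace ℝ (Fin N)) (EuclideanSpace ℝ (Fin M)),
      ∫ x in Ω, ‖s x - v x‖ ^ 2 < η ∧
      ∫ x in Ω, legendre (meanConjugate V) (s x) <
        (∫ x in Ω, legendre (meanConjugate V) (v x)) + η := by
  have : IsFiniteMeasure (volume.restrict Ω) := isFiniteMeasure_restrict.2 hΩf
  have hvm : Measurable v := (Lp.stronglyMeasurable v).measurable
  set S : Set (EuclideanSpace ℝ (Fin M)) := range v ∪ {0}
  set s : ℕ → SimpleFunc (EuclideanSpace ℝ (Fin N)) (EuclideanSpace ℝ (Fin M)) := fun n =>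
    SimpleFunc.approxOn v hvm S 0 (by simp [S]) n
  have hs2 : ∀ n x, ‖s n x‖ ≤ 2 * ‖v x‖ := by
    intro n x
    have := SimpleFunc.norm_approxOn_y₀_le hvm (s := S) (y₀ := 0) (by simp [S]) x n
    simp only [sub_zero] at this
    linarith
  have hlim : ∀ x, Tendsto (fun n => s n x) atTop (𝓝 (v x)) := fun x =>
    SimpleFunc.tendsto_approxOn hvm _ (subset_closure (Or.inl ⟨x, rfl⟩))
  have hv2 : IntegrableOn (fun x => ‖v x‖ ^ 2) Ω := (Lp.memLp v).integrable_norm_pow'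
  have l1 : Tendsto (fun n => ∫ x in Ω, ‖s n x - v x‖ ^ 2) atTop (𝓝 (∫ x in Ω, (0 : ℝ))) := by
    refine tendsto_integral_of_dominated_convergence (fun x => 9 * ‖v x‖ ^ 2)
      (fun n => (((s n).measurable.sub hvm).norm.pow_const 2).aestronglyMeasurable)
      (hv2.const_mul 9) (fun n => ae_of_all _ fun x => ?_) (ae_of_all _ fun x => ?_)
    · rw [Real.norm_of_nonneg (by positivity)]
      have h1 : ‖s n x - v x‖ ≤ 3 * ‖v x‖ := by linarith [norm_sub_le (s n x) (v x), hs2 n x]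
      nlinarith [norm_nonneg (s n x - v x), norm_nonneg (v x)]
    · have := (((hlim x).sub_const (v x)).norm).pow 2
      simpa using this
  have l2 : Tendsto (fun n => ∫ x in Ω, legendre (meanConjugate V) (s n x)) atTop
      (𝓝 (∫ x in Ω, legendre (meanConjugate V) (v x))) := by
    refine tendsto_integral_of_dominated_convergence
      (fun x => 4 * (4 * c) * (1 + 4 * ‖v x‖ ^ 2))
      (fun n => (hV.continuous_legendre_meanConjugate.measurable.comp
        (s n).measurable).aestronglyMeasurable)
      (((integrable_const (1 : ℝ)).add (hv2.const_mul 4)).const_mul _)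
      (fun n => ae_of_all _ fun x => ?_)
      (ae_of_all _ fun x => (hV.continuous_legendre_meanConjugate.tendsto _).comp (hlim x))
    have hc := hV.pos
    refine (hV.growth_legendre_meanConjugate.abs_le (by positivity) _).trans ?_
    have h1 := hs2 n x
    have h2 : ‖s n x‖ ^ 2 ≤ 4 * ‖v x‖ ^ 2 := by nlinarith [norm_nonneg (s n x), norm_nonneg (v x)]
    gcongr
  rw [integral_zero] at l1
  obtain ⟨n, h1, h2⟩ := ((l1.eventually (gt_mem_nhds hη)).and
    (l2.eventually (gt_mem_nhds (lt_add_of_pos_right _ hη)))).exists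
  exact ⟨s n, h1, h2⟩

/-- Approximate recovery of a simple function `s`. On most of the level set `{s = p}`, the sequence
oscillates like a smooth periodic function with mean close to `p` and energy close to optimal. -/
theorem exists_recovery_simpleFunc (hV : IsPeriodicPotential c V) (hN : 1 ≤ N)
    (hΩ : IsOpen Ω) (hΩb : Bornology.IsBounded Ω) {ε δ : ℕ → ℝ}
    (hδ : ∀ n, δ n ∈ Ioo (0 : ℝ) 1) (hδ0 : Tendsto δ atTop (𝓝 0))
    (hεδ : Tendsto (fun n => ε n / δ n) atTop (𝓝 0))
    (s : SimpleFunc (EuclideanSpace ℝ (Fin N)) (EuclideanSpace ℝ (Fin M)))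
    {θ : ℝ} (hθ : 0 < θ) :
    ∃ v' : L2 Ω M, ∫ x in Ω, ‖v' x - s x‖ ^ 2 ≤ θ ∧ ∃ u : ℕ → L2 Ω M,
      (∀ e, Tendsto (fun n => inner ℝ (u n) e) atTop (𝓝 (inner ℝ v' e))) ∧
      ∀ᶠ n in atTop, phaseEnergy Ω V (ε n) (δ n) (u n) ≤
        ENNReal.ofReal ((∫ x in Ω, legendre (meanConjugate V) (s x)) + θ) := by
  have hc := hV.pos
  have hΩf : volume Ω ≠ ⊤ := hΩb.measure_lt_top.ne
  have : IsFiniteMeasure (volume.restrict Ω) := isFiniteMeasure_restrict.2 hΩf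
  have hΩm := hΩ.measurableSet
  set A := volume.real Ω
  have hA : 0 ≤ A := measureReal_nonneg
  set T := s.range
  set H := legendre (meanConjugate V)
  have hH0 : ∀ p, 0 ≤ H p := hV.legendre_meanConjugate_nonneg
  -- the error allowed in each cell problem
  set κ := min 1 (θ / 4 / (A + 1))
  have hκ : 0 < κ := lt_min one_pos (by positivity)
  have hκA : κ * A ≤ θ / 4 := by
    have h1 : κ * (A + 1) ≤ θ / 4 := by
      rw [← le_div_iff₀ (by positivity)]
      exact min_le_right _ _
    nlinarith
  have hκ1 : κ ^ 2 ≤ κ := by nlinarith [min_le_left 1 (θ / 4 / (A + 1))]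
  choose w hws hwp hwm hwe using fun p => hV.exists_smooth_near_legendre_meanConjugate hN p hκ
  choose C hC using fun p => (hwp p).exists_norm_le (hws p).continuous
  set m : EuclideanSpace ℝ (Fin M) → EuclideanSpace ℝ (Fin M) := fun p => ∫ y in unitCube N, w p y
  have hmC : ∀ p, ‖m p‖ ≤ C p := fun p => by
    have := norm_integral_le_of_norm_le_const (μ := volume.restrict (unitCube N))
      (ae_of_all _ (hC p))
    simpa using this
  have hC0 : ∀ p, 0 ≤ C p := fun p => (norm_nonneg _).trans (hmC p)
  -- bounds for the patchwork, and for its distance to `s`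
  set B := ∑ p ∈ T, C p
  set D := B + ∑ p ∈ T, ‖p‖
  set ρ := θ / 4 / (c * (1 + B ^ 2) + D ^ 2)
  have hρ : 0 < ρ := by positivity
  obtain ⟨K, χ, hKc, hKsub, hχs, hχ1, hχK, hχ0, hbad⟩ := exists_smooth_cutoffs hΩm hΩf s hρ
  -- the set where the cutoff functions leave the patchwork uncontrolled, except for its bound `B`
  set Z := Ω \ ⋃ p ∈ T, K p
  have hKm : ∀ p, MeasurableSet (K p) := fun p => (hKc p).measurableSet
  have hZm : MeasurableSet Z := hΩm.diff (Finset.measurableSet_biUnion _ fun p _ => hKm p)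
  have hKΩ : ∀ p, K p ⊆ Ω := fun p => (hKsub p).trans inter_subset_right
  have hKs : ∀ p, ∀ x ∈ K p, s x = p := fun p x hx => (hKsub p hx).1
  have hρc : volume.real Z * (c * (1 + B ^ 2)) ≤ θ / 4 := by
    calc volume.real Z * (c * (1 + B ^ 2)) ≤ ρ * (c * (1 + B ^ 2) + D ^ 2) := by
          gcongr
          nlinarith [sq_nonneg D]
      _ = θ / 4 := div_mul_cancel₀ _ (by positivity)
  have hρD : volume.real Z * D ^ 2 ≤ θ / 4 := by
    calc volume.real Z * D ^ 2 ≤ ρ * (c * (1 + B ^ 2) + D ^ 2) := by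
          gcongr
          have : 0 ≤ c * (1 + B ^ 2) := by positivity
          linarith
      _ = θ / 4 := div_mul_cancel₀ _ (by positivity)
  have hcases : ∀ x ∈ Ω, x ∈ Z ∨ ∃ q ∈ T, x ∈ K q := by
    intro x hx
    by_cases h : x ∈ ⋃ p ∈ T, K p
    · obtain ⟨q, hq, hxq⟩ := mem_iUnion₂.1 h
      exact Or.inr ⟨q, hq, hxq⟩
    · exact Or.inl ⟨hx, h⟩
  have hpatch : ∀ q ∈ T, ∀ x ∈ K q, ∀ f : EuclideanSpace ℝ (Fin M) → EuclideanSpace ℝ (Fin M),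
      ∑ p ∈ T, χ p x • f p = f q := by
    intro q hq x hx f
    rw [Finset.sum_eq_single q]
    · rw [hχK q x hx, one_smul]
    · intro p _ hpq
      rw [hχ0 p q hq hpq x hx, zero_smul]
    · exact fun h => absurd hq h
  -- the weak limit
  set g : EuclideanSpace ℝ (Fin N) → EuclideanSpace ℝ (Fin M) := fun x => ∑ p ∈ T, χ p x • m p
  have hgc : Continuous g := continuous_finsetSum _ fun p _ => (hχs p).continuous.smul
    continuous_const
  have hgB : ∀ x, ‖g x‖ ≤ B := fun x => norm_sum_smul_le (fun p => hχ1 p x) hmC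
  have hgL : MemLp g 2 (volume.restrict Ω) := memLp_of_measurable_of_bounded hgc.measurable ⟨B, hgB⟩
  set U : ℕ → EuclideanSpace ℝ (Fin N) → EuclideanSpace ℝ (Fin M) := fun n =>
    oscillatingPatchwork T χ w (δ n)
  have hUs : ∀ n, ContDiff ℝ ∞ (U n) := fun n => contDiff_oscillatingPatchwork hχs hws (δ n)
  have hUB : ∀ n x, ‖U n x‖ ≤ B := fun n x =>
    norm_sum_smul_le (fun p => hχ1 p x) fun p => hC p _
  have hUL : ∀ n, MemLp (U n) 2 (volume.restrict Ω) := fun n =>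
    memLp_of_measurable_of_bounded (hUs n).continuous.measurable ⟨B, hUB n⟩
  obtain ⟨G, hG⟩ := exists_norm_fderiv_oscillatingPatchwork_le (T := T) hΩb hχs hχ1 hws hwp
  refine ⟨hgL.toLp g, ?_, fun n => (hUL n).toLp (U n), fun e => ?_, ?_⟩
  · -- the weak limit is close to `s`
    have hsb : ∀ x, ‖s x‖ ≤ ∑ p ∈ T, ‖p‖ := fun x =>
      Finset.single_le_sum (f := fun p => ‖p‖) (fun p _ => norm_nonneg p) (s.mem_range_self x)
    have hpt : ∀ x ∈ Ω, ‖g x - s x‖ ^ 2 ≤ κ + Z.indicator (fun _ => D ^ 2) x := by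
      intro x hx
      rcases hcases x hx with hZ | ⟨q, hq, hxq⟩
      · rw [indicator_of_mem hZ]
        have h1 : ‖g x - s x‖ ≤ D := (norm_sub_le _ _).trans (add_le_add (hgB x) (hsb x))
        have h2 := pow_le_pow_left₀ (norm_nonneg _) h1 2
        linarith
      · have h1 : g x = m q := hpatch q hq x hxq m
        rw [h1, hKs q x hxq]
        have h2 := pow_le_pow_left₀ (norm_nonneg _) (hwm q) 2
        have h3 : 0 ≤ Z.indicator (fun _ => D ^ 2) x :=
          indicator_nonneg (fun _ _ => sq_nonneg D) x
        linarith
    have hint : IntegrableOn (fun x => κ + Z.indicator (fun _ => D ^ 2) x) Ω :=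
      (integrable_const κ).add ((integrable_const (D ^ 2)).indicator hZm)
    have hval : ∫ x in Ω, (κ + Z.indicator (fun _ => D ^ 2) x) = κ * A + volume.real Z * D ^ 2 := by
      rw [integral_add (integrable_const κ) ((integrable_const (D ^ 2)).indicator hZm),
        integral_const, integral_indicator_const _ hZm, measureReal_restrict_apply hZm,
        inter_eq_self_of_subset_left sdiff_subset, measureReal_restrict_apply_univ, smul_eq_mul,
        smul_eq_mul, mul_comm A]
    calc ∫ x in Ω, ‖hgL.toLp g x - s x‖ ^ 2 = ∫ x in Ω, ‖g x - s x‖ ^ 2 :=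
          integral_congr_ae (hgL.coeFn_toLp.mono fun x hx => by simp only [hx])
      _ ≤ ∫ x in Ω, (κ + Z.indicator (fun _ => D ^ 2) x) :=
          integral_mono_of_nonneg (ae_of_all _ fun x => sq_nonneg _) hint
            (ae_restrict_of_forall_mem hΩm hpt)
      _ ≤ θ := by rw [hval]; linarith
  · simp only [L2_inner_toLp]
    exact tendsto_integral_inner_oscillatingPatchwork hΩm hΩf hχs hχ1 hws hwp (fun n => (hδ n).1)
      hδ0 e
  · set F : EuclideanSpace ℝ (Fin M) → EuclideanSpace ℝ (Fin N) → ℝ := fun q y => V y (w q y)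
    have hFm : ∀ q, Measurable (F q) := fun q =>
      hV.measurable_uncurry.comp (measurable_id.prodMk (hws q).continuous.measurable)
    have hFp : ∀ q, LatticePeriodic (F q) := fun q x z => by
      simp only [F]
      rw [hV.periodic x z, hwp q x z]
    have hFb : ∀ q x, |F q x| ≤ c * (1 + C q ^ 2) := fun q x => by
      refine ((hV.growth x).abs_le hc _).trans ?_
      gcongr
      exact hC q x
    have hFi : ∀ n q, IntegrableOn (fun x => F q ((δ n)⁻¹ • x)) Ω := fun n q =>
      Integrable.of_bound ((hFm q).comp (measurable_const_smul (δ n)⁻¹)).aestronglyMeasurable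
        (c * (1 + C q ^ 2)) (ae_of_all _ fun x => hFb q _)
    have hpt : ∀ n, ∀ x ∈ Ω, V ((δ n)⁻¹ • x) (U n x) ≤
        (∑ q ∈ T, (K q).indicator (fun x => F q ((δ n)⁻¹ • x)) x) +
          Z.indicator (fun _ => c * (1 + B ^ 2)) x := by
      intro n x hx
      have h0 : ∀ q ∈ T, 0 ≤ (K q).indicator (fun x => F q ((δ n)⁻¹ • x)) x := fun q _ =>
        indicator_nonneg (fun _ _ => hV.nonneg _ _) x
      rcases hcases x hx with hZ | ⟨q, hq, hxq⟩
      · rw [indicator_of_mem hZ]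
        refine le_add_of_nonneg_of_le (Finset.sum_nonneg h0)
          (((hV.growth _).upper _).trans ?_)
        gcongr
        exact hUB n x
      · have h1 : U n x = w q ((δ n)⁻¹ • x) := hpatch q hq x hxq fun p => w p ((δ n)⁻¹ • x)
        rw [h1]
        refine le_add_of_le_of_nonneg ?_ (indicator_nonneg (fun _ _ => by positivity) x)
        refine le_trans ?_ (Finset.single_le_sum h0 hq)
        rw [indicator_of_mem hxq]
    -- the energy on each `K q` converges to the value of the cell problem solved by `w q`
    have hle : ∀ n, ∫ x in Ω, V ((δ n)⁻¹ • x) (U n x) ≤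
        (∑ q ∈ T, ∫ x in K q, F q ((δ n)⁻¹ • x)) + θ / 4 := by
      intro n
      have hi1 : ∀ q ∈ T, IntegrableOn ((K q).indicator fun x => F q ((δ n)⁻¹ • x)) Ω :=
        fun q _ => (hFi n q).indicator (hKm q)
      have hi2 : IntegrableOn (Z.indicator fun _ => c * (1 + B ^ 2)) Ω :=
        (integrable_const _).indicator hZm
      refine (setIntegral_mono_on (hV.integrable_comp (measurable_const_smul (δ n)⁻¹) (hUL n))
        ((integrable_finsetSum T hi1).add hi2) hΩm (hpt n)).trans ?_
      rw [integral_add' (integrable_finsetSum T hi1) hi2, integral_finsetSum T hi1,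
        integral_indicator_const _ hZm, measureReal_restrict_apply hZm,
        inter_eq_self_of_subset_left sdiff_subset, smul_eq_mul]
      refine add_le_add (Finset.sum_le_sum fun q _ => ?_) hρc
      rw [integral_indicator (hKm q), Measure.restrict_restrict (hKm q),
        inter_eq_self_of_subset_left (hKΩ q)]
    have hlim : Tendsto (fun n => (∑ q ∈ T, ∫ x in K q, F q ((δ n)⁻¹ • x)) + θ / 4 +
        (ε n) ^ 2 * (N * (G / δ n) ^ 2) * A) atTop
        (𝓝 ((∑ q ∈ T, volume.real (K q) * ∫ y in unitCube N, F q y) + θ / 4 + 0)) := by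
      refine ((tendsto_finsetSum T fun q _ => ?_).add_const _).add ?_
      · exact tendsto_setIntegral_oscillating (hFm q) (hFp q) (hFb q) (hKm q)
          (measure_ne_top_of_subset (hKΩ q) hΩf) (fun n => (hδ n).1) hδ0
      · have h1 := (hεδ.pow 2).mul_const (N * G ^ 2 * A)
        rw [zero_pow two_ne_zero, zero_mul] at h1
        refine h1.congr fun n => ?_
        rw [div_pow, div_pow]
        ring
    have hsum : ∑ q ∈ T, volume.real (K q) * ∫ y in unitCube N, F q y ≤
        (∫ x in Ω, H (s x)) + θ / 4 := by
      have hHi : IntegrableOn (fun x => H (s x)) Ω := by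
        refine hV.integrable_legendre_meanConjugate (memLp_of_measurable_of_bounded s.measurable
          ⟨∑ p ∈ T, ‖p‖, fun x => ?_⟩)
        exact Finset.single_le_sum (f := fun p => ‖p‖) (fun p _ => norm_nonneg p)
          (s.mem_range_self x)
      have hi1 : ∀ q ∈ T, IntegrableOn ((K q).indicator fun _ => H q + κ) Ω :=
        fun q _ => (integrable_const _).indicator (hKm q)
      calc ∑ q ∈ T, volume.real (K q) * ∫ y in unitCube N, F q y
          ≤ ∑ q ∈ T, volume.real (K q) * (H q + κ) := by
            gcongr with q _
            exact hwe q
        _ = ∫ x in Ω, ∑ q ∈ T, (K q).indicator (fun _ => H q + κ) x := by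
            rw [integral_finsetSum T hi1]
            refine Finset.sum_congr rfl fun q _ => ?_
            rw [integral_indicator_const _ (hKm q), measureReal_restrict_apply (hKm q),
              inter_eq_self_of_subset_left (hKΩ q), smul_eq_mul]
        _ ≤ ∫ x in Ω, (H (s x) + κ) := by
            refine integral_mono (integrable_finsetSum T hi1) (hHi.add (integrable_const κ))
              fun x => ?_
            simp only
            rw [Finset.sum_eq_single (s x)]
            · exact indicator_le_self' (fun _ _ => add_nonneg (hH0 _) hκ.le) x
            · intro q _ hq
              exact indicator_of_notMem (fun h => hq (hKs q x h).symm) _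
            · exact fun h => absurd (s.mem_range_self x) h
        _ ≤ (∫ x in Ω, H (s x)) + θ / 4 := by
            rw [integral_add hHi (integrable_const κ), integral_const,
              measureReal_restrict_apply_univ, smul_eq_mul, mul_comm]
            linarith
    have hlt : (∑ q ∈ T, volume.real (K q) * ∫ y in unitCube N, F q y) + θ / 4 + 0 <
        (∫ x in Ω, H (s x)) + θ := by linarith
    filter_upwards [hlim.eventually (gt_mem_nhds hlt)] with n hn
    refine (phaseEnergy_toLp_le hV hΩ hΩf (hUs n) (hUL n) (hG (δ n) (hδ n)) (ε n) (δ n)).trans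
      (ENNReal.ofReal_le_ofReal ?_)
    linarith [hle n]

theorem exists_recovery_approximate (hV : IsPeriodicPotential c V) (hN : 1 ≤ N)
    (hΩ : IsOpen Ω) (hΩb : Bornology.IsBounded Ω) {ε δ : ℕ → ℝ}
    (hδ : ∀ n, δ n ∈ Ioo (0 : ℝ) 1) (hδ0 : Tendsto δ atTop (𝓝 0))
    (hεδ : Tendsto (fun n => ε n / δ n) atTop (𝓝 0)) (v : L2 Ω M) {η : ℝ} (hη : 0 < η) :
    ∃ v' : L2 Ω M, ‖v' - v‖ ≤ η ∧ ∃ u : ℕ → L2 Ω M,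
      (∀ e, Tendsto (fun n => inner ℝ (u n) e) atTop (𝓝 (inner ℝ v' e))) ∧
      ∀ᶠ n in atTop, phaseEnergy Ω V (ε n) (δ n) (u n) ≤
        ENNReal.ofReal (∫ x in Ω, legendre (meanConjugate V) (v x)) + ENNReal.ofReal η := by
  have hΩf : volume Ω ≠ ⊤ := hΩb.measure_lt_top.ne
  have : IsFiniteMeasure (volume.restrict Ω) := isFiniteMeasure_restrict.2 hΩf
  set θ := min (η ^ 2 / 4) (η / 2)
  have hθ : 0 < θ := lt_min (by positivity) (by positivity)
  obtain ⟨s, hs1, hs2⟩ := hV.exists_simpleFunc_near hΩf v hθ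
  obtain ⟨v', hv', u, hu, hE⟩ := hV.exists_recovery_simpleFunc hN hΩ hΩb hδ hδ0 hεδ s hθ
  refine ⟨v', ?_, u, hu, hE.mono fun n hn => hn.trans ?_⟩
  · have hsL : MemLp s 2 (volume.restrict Ω) := SimpleFunc.memLp_of_isFiniteMeasure s 2 _
    have i1 : IntegrableOn (fun x => ‖v' x - s x‖ ^ 2) Ω :=
      ((Lp.memLp v').sub hsL).integrable_norm_pow'
    have i2 : IntegrableOn (fun x => ‖s x - v x‖ ^ 2) Ω :=
      (hsL.sub (Lp.memLp v)).integrable_norm_pow'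
    have h1 : ‖v' - v‖ ^ 2 ≤
        2 * (∫ x in Ω, ‖v' x - s x‖ ^ 2) + 2 * ∫ x in Ω, ‖s x - v x‖ ^ 2 := by
      rw [L2_norm_sq_eq, ← integral_const_mul, ← integral_const_mul,
        ← integral_add (i1.const_mul 2) (i2.const_mul 2)]
      refine integral_mono_ae (Lp.memLp _).integrable_norm_pow'
        ((i1.const_mul 2).add (i2.const_mul 2)) ?_
      filter_upwards [Lp.coeFn_sub v' v] with x hx
      rw [hx, Pi.sub_apply]
      have h3 := norm_sub_le_norm_sub_add_norm_sub (v' x) (s x) (v x)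
      nlinarith [sq_nonneg (‖v' x - s x‖ - ‖s x - v x‖), norm_nonneg (v' x - v x)]
    have h2 : ‖v' - v‖ ^ 2 ≤ η ^ 2 := by linarith [min_le_left (η ^ 2 / 4) (η / 2)]
    exact (pow_le_pow_iff_left₀ (norm_nonneg _) hη.le two_ne_zero).1 h2
  · rw [← ENNReal.ofReal_add (integral_nonneg fun x => hV.legendre_meanConjugate_nonneg _) hη.le]
    exact ENNReal.ofReal_le_ofReal (by linarith [min_le_right (η ^ 2 / 4) (η / 2)])

end IsPeriodicPotential

/-! ### The double well potential -/

/-- A double well potential agrees almost everywhere with a periodic potential that has quadratic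
growth at every point: the growth bounds are enforced by truncation, which has an effect on a null
set only. -/
theorem IsDoubleWell.exists_isPeriodicPotential {N M k : ℕ}
    {W : EuclideanSpace ℝ (Fin N) → EuclideanSpace ℝ (Fin M) → ℝ}
    {a b : EuclideanSpace ℝ (Fin N) → EuclideanSpace ℝ (Fin M)}
    {E : Fin k → Set (EuclideanSpace ℝ (Fin N))}
    {Wp : Fin k → EuclideanSpace ℝ (Fin N) → EuclideanSpace ℝ (Fin M) → ℝ}
    {ap bp : Fin k → EuclideanSpace ℝ (Fin N) → EuclideanSpace ℝ (Fin M)}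
    (hW : IsDoubleWell W a b E Wp ap bp) :
    ∃ (c : ℝ) (V : EuclideanSpace ℝ (Fin N) → EuclideanSpace ℝ (Fin M) → ℝ),
      IsPeriodicPotential c V ∧ ∀ᵐ x, W x = V x := by
  obtain ⟨c₂, hc₂, hg⟩ := hW.growth
  -- `1 ≤ c` makes the lower growth bound smaller than the upper one
  set c := max c₂ 1
  have hc1 : 1 ≤ c := le_max_right _ _
  have hc : 0 < c := one_pos.trans_le hc1
  have hcc : c₂ ≤ c := le_max_left _ _
  set Wt : EuclideanSpace ℝ (Fin N) → EuclideanSpace ℝ (Fin M) → ℝ := fun x p =>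
    ∑ i, (E i).indicator (fun y => Wp i y p) (cellPart x) with hWt
  have hcont : ∀ i, ContinuousOn (fun z : EuclideanSpace ℝ (Fin N) × EuclideanSpace ℝ (Fin M) =>
      Wp i z.1 z.2) (closure (E i) ×ˢ univ) := fun i => (hW.piece_locallyLipschitz i).continuousOn
  have hWtm : ∀ p, Measurable fun x => Wt x p := by
    intro p
    refine Finset.measurable_sum _ fun i _ => ?_
    have hc : ContinuousOn (fun y => Wp i y p) (E i) := (hcont i).comp
      (f := fun y => (y, p)) (by fun_prop) fun y hy => ⟨subset_closure hy, mem_univ _⟩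
    have hm : Measurable ((E i).indicator fun y => Wp i y p) := by
      classical
      rw [← piecewise_eq_indicator]
      exact hc.measurable_piecewise continuousOn_const (hW.isOpen_piece i).measurableSet
    exact hm.comp measurable_cellPart
  have hWtc : ∀ x, Continuous (Wt x) := by
    intro x
    refine continuous_finsetSum _ fun i _ => ?_
    by_cases hx : cellPart x ∈ E i
    · simp only [indicator_of_mem hx]
      exact (hcont i).comp_continuous (f := fun p => (cellPart x, p)) (by fun_prop)
        fun p => ⟨subset_closure hx, mem_univ _⟩
    · simp only [indicator_of_notMem hx]
      exact continuous_const
  set V : EuclideanSpace ℝ (Fin N) → EuclideanSpace ℝ (Fin M) → ℝ := fun x p =>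
    max (max 0 (‖p‖ ^ 2 / c - c)) (min (Wt x p) (c * (1 + ‖p‖ ^ 2))) with hV
  refine ⟨c, V, ⟨hc, fun p => ?_, fun x => ?_, fun x z => ?_, fun x p => ?_, fun x => ⟨?_, ?_⟩⟩, ?_⟩
  · exact measurable_const.max ((hWtm p).min measurable_const)
  · have := hWtc x
    fun_prop
  · ext p
    simp only [hV, hWt, latticePeriodic_cellPart x z]
  · exact (le_max_left _ _).trans (le_max_left _ _)
  · exact fun p => (le_max_right _ _).trans (le_max_left _ _)
  · intro p
    have h0 : 0 ≤ c * (1 + ‖p‖ ^ 2) := by positivity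
    refine max_le (max_le h0 ?_) (min_le_right _ _)
    have h1 : ‖p‖ ^ 2 / c ≤ ‖p‖ ^ 2 := div_le_self (sq_nonneg _) hc1
    nlinarith [sq_nonneg ‖p‖]
  · filter_upwards [hW.W_eq, hg] with x hx hgx
    ext p
    have h1 : W x p = Wt x p := hx p
    simp only [hV]
    rw [← h1, min_eq_left, max_eq_right]
    · refine max_le (hW.nonneg x p) ?_
      by_cases hp : c₂ ≤ ‖p‖
      · have h2 := (hgx p).1 hp
        have h3 : ‖p‖ ^ 2 / c ≤ 1 / c₂ * ‖p‖ ^ 2 := by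
          rw [one_div, inv_mul_eq_div]
          gcongr
        linarith
      · have h2 : ‖p‖ ^ 2 / c ≤ c := by
          rw [div_le_iff₀ hc]
          nlinarith [norm_nonneg p]
        linarith [hW.nonneg x p]
    · refine (hgx p).2.trans ?_
      gcongr

section Congr

variable {N M : ℕ} {W V : EuclideanSpace ℝ (Fin N) → EuclideanSpace ℝ (Fin M) → ℝ}

theorem phaseEnergy_congr (h : ∀ᵐ x, W x = V x) (Ω : Set (EuclideanSpace ℝ (Fin N))) (ε : ℝ)
    {δ : ℝ} (hδ : 0 < δ) : phaseEnergy Ω W ε δ = phaseEnergy (M := M) Ω V ε δ := by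
  have hδ' : ∀ᵐ x : EuclideanSpace ℝ (Fin N), W (δ⁻¹ • x) = V (δ⁻¹ • x) := by
    rw [ae_iff] at h ⊢
    have := Measure.addHaar_preimage_smul volume (inv_ne_zero hδ.ne')
      {x : EuclideanSpace ℝ (Fin N) | ¬W x = V x}
    rwa [h, mul_zero] at this
  ext u
  unfold phaseEnergy
  split_ifs with hu
  · refine lintegral_congr_ae ?_
    filter_upwards [ae_restrict_of_ae hδ'] with x hx
    rw [hx]
  · rfl

theorem cellValues_congr (h : ∀ᵐ x, W x = V x) (p : EuclideanSpace ℝ (Fin M)) :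
    cellValues W p = cellValues V p := by
  have key : ∀ φ : EuclideanSpace ℝ (Fin N) → EuclideanSpace ℝ (Fin M),
      ∫⁻ y in unitCube N, ENNReal.ofReal (convexEnvelope (W y) (p + φ y)) =
      ∫⁻ y in unitCube N, ENNReal.ofReal (convexEnvelope (V y) (p + φ y)) := fun φ => by
    refine lintegral_congr_ae ?_
    filter_upwards [ae_restrict_of_ae h] with y hy
    rw [hy]
  simp only [cellValues, key]

end Congr

/-! ### Γ-convergence -/

namespace IsPeriodicPotential

variable {N M : ℕ} {c : ℝ} {V : EuclideanSpace ℝ (Fin N) → EuclideanSpace ℝ (Fin M) → ℝ}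
  {Ω : Set (EuclideanSpace ℝ (Fin N))}

theorem homPotential_eq (hV : IsPeriodicPotential c V) (hN : 1 ≤ N) (p : EuclideanSpace ℝ (Fin M)) :
    homPotential V p = ENNReal.ofReal (legendre (meanConjugate V) p) :=
  (hV.isLeast_cellValues hN p).csInf_eq

theorem homEnergy_eq (hV : IsPeriodicPotential c V) (hN : 1 ≤ N) (hΩf : volume Ω ≠ ⊤)
    (v : L2 Ω M) :
    homEnergy Ω V v = ENNReal.ofReal (∫ x in Ω, legendre (meanConjugate V) (v x)) := by
  have : IsFiniteMeasure (volume.restrict Ω) := isFiniteMeasure_restrict.2 hΩf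
  simp only [homEnergy, hV.homPotential_eq hN]
  exact (ofReal_integral_eq_lintegral_ofReal (hV.integrable_legendre_meanConjugate (Lp.memLp v))
    (ae_of_all _ fun x => hV.legendre_meanConjugate_nonneg _)).symm

theorem ofReal_integral_le_phaseEnergy (hV : IsPeriodicPotential c V) (hΩf : volume Ω ≠ ⊤)
    (ε δ : ℝ) (u : L2 Ω M) :
    ENNReal.ofReal (∫ x in Ω, V (δ⁻¹ • x) (u x)) ≤ phaseEnergy Ω V ε δ u := by
  have : IsFiniteMeasure (volume.restrict Ω) := isFiniteMeasure_restrict.2 hΩf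
  unfold phaseEnergy
  split_ifs with hu
  · rw [ofReal_integral_eq_lintegral_ofReal
      (hV.integrable_comp (measurable_const_smul δ⁻¹) (Lp.memLp u))
      (ae_of_all _ fun x => hV.nonneg _ _)]
    exact lintegral_mono fun x => ENNReal.ofReal_le_ofReal (le_add_of_nonneg_right (by positivity))
  · exact le_top

/-- Equicoercivity in `L²`. -/
theorem exists_norm_le_of_phaseEnergy_le (hV : IsPeriodicPotential c V) (hΩf : volume Ω ≠ ⊤)
    {L : ℝ≥0∞} (hL : L ≠ ⊤) :
    ∃ R : ℝ, ∀ (ε δ : ℝ) (u : L2 Ω M), phaseEnergy Ω V ε δ u ≤ L → ‖u‖ ≤ R := by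
  have : IsFiniteMeasure (volume.restrict Ω) := isFiniteMeasure_restrict.2 hΩf
  refine ⟨Real.sqrt (c * (L.toReal + c * (volume.restrict Ω).real univ)), fun ε δ u hu => ?_⟩
  refine Real.le_sqrt_of_sq_le ((hV.norm_sq_le (measurable_const_smul δ⁻¹) u).trans ?_)
  have h1 := (hV.ofReal_integral_le_phaseEnergy hΩf ε δ u).trans hu
  have h2 := (ENNReal.ofReal_le_iff_le_toReal hL).1 h1
  have := hV.pos
  gcongr

theorem homEnergy_le_liminf (hV : IsPeriodicPotential c V) (hN : 1 ≤ N) (hΩ : MeasurableSet Ω)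
    (hΩf : volume Ω ≠ ⊤) (ε : ℕ → ℝ) {δ : ℕ → ℝ} (hδ : ∀ n, 0 < δ n)
    (hδ0 : Tendsto δ atTop (𝓝 0)) {u : ℕ → L2 Ω M} {v : L2 Ω M} (h : WeaklyConverges u v) :
    homEnergy Ω V v ≤ liminf (fun n => phaseEnergy Ω V (ε n) (δ n) (u n)) atTop := by
  have h' := tendsto_toWeakSpace_iff.1 h
  rw [hV.homEnergy_eq hN hΩf]
  refine ENNReal.le_of_forall_pos_le_add fun η hη _ => ?_
  rw [← tsub_le_iff_right]
  refine le_liminf_of_le (by isBoundedDefault) ?_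
  filter_upwards [hV.eventually_integral_legendre_meanConjugate_le hΩ hΩf hδ hδ0 h'
    (NNReal.coe_pos.2 hη)] with n hn
  refine le_trans ?_ (hV.ofReal_integral_le_phaseEnergy hΩf (ε n) (δ n) (u n))
  rw [← ENNReal.ofReal_coe_nnreal, ← ENNReal.ofReal_sub _ η.coe_nonneg]
  exact ENNReal.ofReal_le_ofReal hn

theorem gammaConverges_phaseEnergy (hV : IsPeriodicPotential c V) (hN : 1 ≤ N)
    (hΩ : IsOpen Ω) (hΩb : Bornology.IsBounded Ω) {ε δ : ℕ → ℝ}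
    (hδ : ∀ n, δ n ∈ Ioo (0 : ℝ) 1) (hδ0 : Tendsto δ atTop (𝓝 0))
    (hεδ : Tendsto (fun n => ε n / δ n) atTop (𝓝 0)) :
    GammaConverges (fun n => phaseEnergy (M := M) Ω V (ε n) (δ n)) (homEnergy Ω V) := by
  have hΩf : volume Ω ≠ ⊤ := hΩb.measure_lt_top.ne
  refine ⟨fun v u h => hV.homEnergy_le_liminf hN hΩ.measurableSet hΩf ε (fun n => (hδ n).1) hδ0 h,
    fun v => ?_⟩
  have := separableSpace_L2 (μ := volume.restrict Ω) (P := EuclideanSpace ℝ (Fin M))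
  rw [hV.homEnergy_eq hN hΩf]
  obtain ⟨R, hR⟩ := hV.exists_norm_le_of_phaseEnergy_le hΩf (L := ENNReal.ofReal
    (∫ x in Ω, legendre (meanConjugate V) (v x)) + 1) (by simp)
  obtain ⟨u, hu, hE⟩ := exists_recovery_of_approximate
    (G := fun n => phaseEnergy (M := M) Ω V (ε n) (δ n)) (fun n => hR (ε n) (δ n))
    fun η hη => hV.exists_recovery_approximate hN hΩ hΩb hδ hδ0 hεδ v hη
  exact ⟨u, tendsto_toWeakSpace_iff.2 hu, hE⟩

theorem exists_weaklyConverges_subseq (hV : IsPeriodicPotential c V) (hN : 1 ≤ N)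
    (hΩf : volume Ω ≠ ⊤) {ε δ : ℕ → ℝ} {u : ℕ → L2 Ω M}
    (hu : (⨆ n, phaseEnergy Ω V (ε n) (δ n) (u n)) < ⊤) :
    ∃ σ : ℕ → ℕ, StrictMono σ ∧ ∃ v : L2 Ω M,
      WeaklyConverges (fun j => u (σ j)) v ∧ homEnergy Ω V v < ⊤ := by
  obtain ⟨R, hR⟩ := hV.exists_norm_le_of_phaseEnergy_le hΩf hu.ne
  have := separableSpace_L2 (μ := volume.restrict Ω) (P := EuclideanSpace ℝ (Fin M))
  obtain ⟨σ, hσ, v, hv⟩ := exists_subseq_tendsto_inner fun n =>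
    hR _ _ (u n) (le_iSup (fun n => phaseEnergy Ω V (ε n) (δ n) (u n)) n)
  refine ⟨σ, hσ, v, tendsto_toWeakSpace_iff.2 hv, ?_⟩
  rw [hV.homEnergy_eq hN hΩf]
  exact ENNReal.ofReal_lt_top

end IsPeriodicPotential

theorem theorem4p1 {N M k : ℕ} (hN : 1 ≤ N) (hM : 1 ≤ M)
    (Ω : Set (EuclideanSpace ℝ (Fin N))) (hΩ : IsOpen Ω) (hΩb : Bornology.IsBounded Ω)
    (W : EuclideanSpace ℝ (Fin N) → EuclideanSpace ℝ (Fin M) → ℝ)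
    (a b : EuclideanSpace ℝ (Fin N) → EuclideanSpace ℝ (Fin M))
    (E : Fin k → Set (EuclideanSpace ℝ (Fin N)))
    (Wp : Fin k → EuclideanSpace ℝ (Fin N) → EuclideanSpace ℝ (Fin M) → ℝ)
    (ap bp : Fin k → EuclideanSpace ℝ (Fin N) → EuclideanSpace ℝ (Fin M))
    (hW : IsDoubleWell W a b E Wp ap bp)
    (ε δ : ℕ → ℝ) (hε : ∀ n, ε n ∈ Set.Ioo (0 : ℝ) 1) (hδ : ∀ n, δ n ∈ Set.Ioo (0 : ℝ) 1)
    (hε0 : Tendsto ε atTop (𝓝 0)) (hδ0 : Tendsto δ atTop (𝓝 0))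
    (hεδ : Tendsto (fun n => ε n / δ n) atTop (𝓝 0)) :
    -- the minimum that defines the homogenized potential is attained
    (∀ p, IsLeast (cellValues W p) (homPotential W p)) ∧
    -- compactness
    (∀ u : ℕ → L2 Ω M, (⨆ n, phaseEnergy Ω W (ε n) (δ n) (u n)) < ⊤ →
      ∃ σ : ℕ → ℕ, StrictMono σ ∧ ∃ v : L2 Ω M,
        WeaklyConverges (fun j => u (σ j)) v ∧ homEnergy Ω W v < ⊤) ∧
    -- Γ-convergence
    GammaConverges (fun n => phaseEnergy Ω W (ε n) (δ n)) (homEnergy Ω W) := by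
  obtain ⟨c, V, hV, hWV⟩ := hW.exists_isPeriodicPotential
  have hcell : cellValues W = cellValues V := funext fun p => cellValues_congr hWV p
  have hpot : homPotential W = homPotential V := by
    ext p
    simp only [homPotential, hcell]
  have hhom : homEnergy (M := M) Ω W = homEnergy Ω V := by
    ext v
    simp only [homEnergy, hpot]
  have hphase : ∀ n, phaseEnergy (M := M) Ω W (ε n) (δ n) = phaseEnergy Ω V (ε n) (δ n) :=
    fun n => phaseEnergy_congr hWV Ω (ε n) (hδ n).1
  simp only [hcell, hpot, hhom, hphase]
  refine ⟨fun p => ?_, fun u hu => hV.exists_weaklyConverges_subseq hN hΩb.measure_lt_top.ne hu,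
    hV.gammaConverges_phaseEnergy hN hΩ hΩb hδ hδ0 hεδ⟩
  rw [hV.homPotential_eq hN]
  exact hV.isLeast_cellValues hN p
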